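/- All Lie algebras are finite dimensional. A linear map $A$ of a finite dimensional rational vector space is called *hyperbolic* if no complex eigenvalue of $A$ has absolute value $1$, and *integer-like* if its characteristic polynomial has integer coefficients and $\det A = \pm 1$. An *Anosov Lie algebra* is a nilpotent Lie algebra $\mathfrak{n}$ over $\mathbb{Q}$ that admits a Lie algebra automorphism which is both hyperbolic and integer-like. The *type* of a nilpotent Lie algebra $\mathfrak{n}$ of nilpotency class $c$ is the $c$-tuple $(n_1, \ldots, n_c)$ with $n_i = \dim \gamma_i(\mathfrak{n})/\gamma_{i+1}(\mathfrak{n})$, where $\gamma_1(\mathfrak{n}) = \mathfrak{n}$ and $\gamma_{i+1}(\mathfrak{n}) = [\mathfrak{n}, \gamma_i(\mathfrak{n})]$. A *positive grading* of $\mathfrak{n}$ is a vector space decomposition $\mathfrak{n} = \bigoplus_{i > 0} \mathfrak{n}_i$, indexed by the positive integers, with $[\mathfrak{n}_i, \mathfrak{n}_j] \subseteq \mathfrak{n}_{i+j}$ for all $i, j > 0$. **Proposition.** There is no Anosov Lie algebra of type $(6,2,3)$, and every Anosov Lie algebra of type $(6,2,2)$ admits a positive grading (over $\mathbb{Q}$).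 -/

import Mathlib

/-- The `i`-th entry, counted from `0`, of the type of a Lie algebra: the dimension of
`γ_{i+1}(𝔫) / γ_{i+2}(𝔫)`, where `γ_1(𝔫) = 𝔫` and `γ_{k+1}(𝔫) = [𝔫, γ_k(𝔫)]`. Mathlib numbers the
lower central series from `0`, so that `lowerCentralSeries K L L i` is `γ_{i+1}(𝔫)`. -/
noncomputable def lieTypeEntry (K L : Type*) [Field K] [LieRing L] [LieAlgebra K L] (i : ℕ) : ℕ :=
  Module.finrank K
    ((LieModule.lowerCentralSeries K L L i).toSubmodule ⧸
      (LieModule.lowerCentralSeries K L L (i + 1)).toSubmodule.submoduleOf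
        (LieModule.lowerCentralSeries K L L i).toSubmodule)

/-- The type `(n_1, …, n_c)` of a finite dimensional nilpotent Lie algebra, `c` being its
nilpotency class and `n_i = dim γ_i(𝔫) / γ_{i+1}(𝔫)`. -/
noncomputable def lieType (K L : Type*) [Field K] [LieRing L] [LieAlgebra K L] : List ℕ :=
  (List.range (LieModule.nilpotencyLength L L)).map (lieTypeEntry K L)

/-- A linear map of a finite dimensional rational vector space is hyperbolic if none of its
(complex) eigenvalues, i.e. of the complex roots of its characteristic polynomial, has absolute
value `1`. -/
def IsHyperbolicMap {V : Type*} [AddCommGroup V] [Module ℚ V] [Module.Finite ℚ V]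
    (f : V →ₗ[ℚ] V) : Prop :=
  ∀ z : ℂ, Polynomial.aeval z f.charpoly = 0 → ‖z‖ ≠ 1

/-- A linear map of a finite dimensional rational vector space is integer-like if its
characteristic polynomial has integer coefficients and its determinant is `1` or `-1`. -/
def IsIntegerLike {V : Type*} [AddCommGroup V] [Module ℚ V] [Module.Finite ℚ V]
    (f : V →ₗ[ℚ] V) : Prop :=
  (∃ p : Polynomial ℤ, p.map (Int.castRingHom ℚ) = f.charpoly) ∧
    (LinearMap.det f = 1 ∨ LinearMap.det f = -1)

/-- An Anosov automorphism of a finite dimensional rational Lie algebra. -/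
def IsAnosovAutomorphism {L : Type*} [LieRing L] [LieAlgebra ℚ L] [Module.Finite ℚ L]
    (A : L ≃ₗ⁅ℚ⁆ L) : Prop :=
  IsHyperbolicMap (A.toLinearEquiv : L →ₗ[ℚ] L) ∧ IsIntegerLike (A.toLinearEquiv : L →ₗ[ℚ] L)

/-- An Anosov Lie algebra: a (finite dimensional) nilpotent rational Lie algebra that admits an
Anosov automorphism. -/
def IsAnosovLieAlgebra (L : Type*) [LieRing L] [LieAlgebra ℚ L] [Module.Finite ℚ L] : Prop :=
  LieRing.IsNilpotent L ∧ ∃ A : L ≃ₗ⁅ℚ⁆ L, IsAnosovAutomorphism A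

/-- A positive grading: a decomposition `𝔫 = ⨁_{i > 0} 𝔫_i` into subspaces with
`[𝔫_i, 𝔫_j] ⊆ 𝔫_{i+j}`. -/
def HasPositiveGrading (K L : Type*) [Field K] [LieRing L] [LieAlgebra K L] : Prop :=
  ∃ n : ℕ+ → Submodule K L,
    DirectSum.IsInternal n ∧ ∀ i j : ℕ+, ∀ x ∈ n i, ∀ y ∈ n j, ⁅x, y⁆ ∈ n (i + j)

/-!
The two halves are proved by the same analysis over an algebraic closure `F` of `ℚ`. Let `f` be
the extension of an Anosov automorphism to `M = F ⊗ L`. The generalized eigenspaces `M_a` of `f`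
satisfy `⁅M_a, M_b⁆ ⊆ M_{a b}` (`lie_mem_maxGenEigenspace`). The eigenvalues are units of the ring
of algebraic integers and none is a root of unity; hence none is rational, the induced maps on
`γ₃` and on `γ₂ / γ₃` (of dimension at most three) have irreducible characteristic polynomials,
and the products of their eigenvalues `ν i`, respectively `μ j`, are `±1`. Eigenvectors `Z i` of
`γ₃` and lifts `Y j` to `γ₂` of eigenvectors of `γ₂ / γ₃` are collected in an `EigenFrame`
(`exists_eigenFrame`).

Call `(ν i, μ j)` connected if some `x ∈ M_{ν i / μ j}` has `⁅x, Y j⁆ ≠ 0`; such an `x` may be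
normalized so that `⁅x, Y j'⁆ = δ Z i`. The set of connected pairs is nonempty, as `γ₃ = ⁅M, γ₂⁆`,
and stable under the Galois group.

If all pairs are connected, via elements `X i j`, then `M` is spanned by these and by the
centralizer of `γ₂`, and applying suitable `X m p` to brackets of such elements, the Jacobi
identity puts all of them into `γ₃`, which is absurd (`EigenFrame.false_of_forall_pairs`). This
uses an index `m` different from `i` and `k` when the bracket is `⁅X i j, X k l⁆`. When `dim γ₃ =
3` there always is one, and the Galois group is transitive on the pairs because an irreducible
cubic stays irreducible over a quadratic field; so type `(6, 2, 3)` is impossible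
(`false_of_three`). When `dim γ₃ = 2` the missing brackets, with `i ≠ k`, have an eigenvalue `± 1
/ (μ j * μ l)` which does not occur on `γ₂ / γ₃` (`EigenFrame.false_of_forall_isPaired`).

So in type `(6, 2, 2)` the connected pairs are, after renumbering, `(ν 0, μ 0)` and `(ν 1, μ 1)`,
via `X 0` and `X 1`. The Jacobi identity and the eigenvalues then give `U 0`, `U 1` in the
centralizer of `γ₂` such that among `X 0, X 1, U 0, U 1` only the brackets `⁅X i, U i⁆` are
nonzero, and these span `γ₂` modulo `γ₃` (`EigenFrame.exists_partners`). The span of the four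
elements is a complement of the rational subspace `D = derivedCore`, the centralizer of `γ₂`
intersected with the preimage of the centre of `L / γ₃`. As `dim D / γ₂ = 6 - 4 = 2`, the brackets
of `D` span at most a rational line stable under the automorphism, hence `⁅D, D⁆ = 0`
(`lie_eq_zero_of_mem_derivedCore`). Giving the four elements the weight `1`, a complement of `γ₃`
in `D` which contains their brackets the weight `2`, and `γ₃` the weight `3` defines a grading of
`M`.

This grading descends to `ℚ`: the derivation with eigenvalues `1`, `2`, `3` on it induces `1`,
`2`, `3` on the quotients of the rational filtration `L ⊇ D ⊇ γ₃`, and these conditions are affine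
linear equations with rational coefficients, so a `ℚ`-linear retraction `F → ℚ` turns the solution
over `F` into one over `ℚ` (`exists_derivation_descent`), whose eigenspaces form the grading.
-/

open Module LieModule

/-! ### Generalized eigenspaces of a bracket preserving map -/

section GeneralizedEigenspaces

variable {F M : Type*} [Field F]

/-- For a bracket preserving map, generalized eigenspaces multiply. -/
theorem lie_mem_maxGenEigenspace [LieRing M] [LieAlgebra F M] {f : End F M}
    (hf : ∀ x y, f ⁅x, y⁆ = ⁅f x, f y⁆) {a b : F} {x y : M}
    (hx : x ∈ f.maxGenEigenspace a) (hy : y ∈ f.maxGenEigenspace b) :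
    ⁅x, y⁆ ∈ f.maxGenEigenspace (a * b) := by
  rw [End.mem_maxGenEigenspace] at hx hy ⊢
  obtain ⟨i, hi⟩ := hx
  obtain ⟨j, hj⟩ := hy
  have key : ∀ n i j : ℕ, i + j ≤ n → ∀ x y : M, ((f - a • 1) ^ i) x = 0 →
      ((f - b • 1) ^ j) y = 0 → ((f - (a * b) • 1) ^ n) ⁅x, y⁆ = 0 := by
    intro n
    induction n with
    | zero =>
      intro i j hij x y hx _
      obtain rfl : i = 0 := by omega
      simp_all
    | succ n ih =>
      intro i j hij x y hx hy
      rcases i with - | i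
      · simp_all
      rcases j with - | j
      · simp_all
      rw [pow_succ, End.mul_apply] at hx hy ⊢
      have h1 : (f - (a * b) • 1) ⁅x, y⁆ =
          ⁅(f - a • 1) x, f y⁆ + a • ⁅x, (f - b • 1) y⁆ := by
        simp [hf, lie_sub, sub_lie]
        module
      rw [h1, map_add, map_smul, ih i (j + 1) (by omega) _ _ hx, ih (i + 1) j (by omega) x _ _ hy,
        smul_zero, add_zero]
      · rwa [pow_succ, End.mul_apply]
      · have hc : Commute ((f - b • 1) ^ (j + 1)) f :=
          ((Commute.refl f).sub_left ((Commute.one_left f).smul_left b)).pow_left _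
        rw [← End.mul_apply, hc.eq, End.mul_apply, pow_succ, End.mul_apply, hy, map_zero]
  exact ⟨i + j, key _ i j le_rfl x y hi hj⟩

variable [AddCommGroup M] [Module F M] {f : End F M}

theorem hasEigenvalue_of_mem_maxGenEigenspace {a : F} {x : M}
    (hx : x ∈ f.maxGenEigenspace a) (h0 : x ≠ 0) : f.HasEigenvalue a := by
  rw [End.mem_maxGenEigenspace] at hx
  obtain ⟨k, hk⟩ := hx
  refine End.hasEigenvalue_of_hasGenEigenvalue (k := k) ?_
  change f.genEigenspace a k ≠ ⊥
  rw [Submodule.ne_bot_iff]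
  exact ⟨x, by rw [End.mem_genEigenspace_nat]; simpa using hk, h0⟩

/-- An eigenvector of a quotient `N / N'` of invariant subspaces lifts to a generalized
eigenvector: apply the polynomial projection onto the generalized eigenspace. -/
theorem exists_maxGenEigenspace_lift [FiniteDimensional F M] {N N' : Submodule F M}
    (hN : ∀ x ∈ N, f x ∈ N) (hN' : ∀ x ∈ N', f x ∈ N') {a : F} {y : M} (hy : y ∈ N)
    (hya : f y - a • y ∈ N') :
    ∃ y' ∈ N, y' ∈ f.maxGenEigenspace a ∧ y' - y ∈ N' := by
  have hpoly : ∀ (W : Submodule F M), (∀ x ∈ W, f x ∈ W) → ∀ (p : Polynomial F), ∀ x ∈ W,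
      Polynomial.aeval f p x ∈ W := by
    intro W hW p x hx
    induction p using Polynomial.induction_on' with
    | add p q hp hq => simpa using W.add_mem hp hq
    | monomial k c =>
      rw [Polynomial.aeval_monomial]
      have : ∀ k : ℕ, (f ^ k) x ∈ W := by
        intro k
        induction k with
        | zero => simpa
        | succ k ih => rw [pow_succ', End.mul_apply]; exact hW _ ih
      simpa [Module.algebraMap_end_apply] using W.smul_mem c (this k)
  obtain ⟨q, hq, hdvd⟩ := Polynomial.exists_eq_pow_rootMultiplicity_mul_and_not_dvd f.charpoly
    f.charpoly_monic.ne_zero a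
  set k := f.charpoly.rootMultiplicity a
  have hcop : IsCoprime ((Polynomial.X - Polynomial.C a) ^ (k + 1)) q :=
    ((Polynomial.irreducible_X_sub_C a).coprime_iff_not_dvd.2 hdvd).pow_left
  obtain ⟨s, t, hst⟩ := hcop
  have heval : (t * q).eval a = 1 := by
    have := congrArg (Polynomial.eval a) hst
    simpa using this
  refine ⟨Polynomial.aeval f (t * q) y, hpoly N hN _ _ hy, ?_, ?_⟩
  · rw [End.mem_maxGenEigenspace]
    refine ⟨k, ?_⟩
    have h1 : (f - a • 1) ^ k = Polynomial.aeval f ((Polynomial.X - Polynomial.C a) ^ k) := by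
      simp [Algebra.algebraMap_eq_smul_one]
    rw [h1, ← End.mul_apply, ← map_mul]
    have h2 : (Polynomial.X - Polynomial.C a) ^ k * (t * q) = t * f.charpoly := by
      rw [hq]; ring
    rw [h2, map_mul, LinearMap.aeval_self_charpoly, mul_zero, LinearMap.zero_apply]
  · obtain ⟨w, hw⟩ := Polynomial.X_sub_C_dvd_sub_C_eval (a := a) (p := t * q)
    rw [heval] at hw
    have h1 : Polynomial.aeval f (t * q) y - y = Polynomial.aeval f w (f y - a • y) := by
      have := congrArg (fun p => Polynomial.aeval f p y) hw
      simp only [map_sub, mul_comm (_ - _) w] at this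
      simpa [Algebra.algebraMap_eq_smul_one] using this
    rw [h1]
    exact hpoly N' hN' _ _ hya

end GeneralizedEigenspaces

/-! ### The lower central series in class three -/

section LowerCentralSeries

variable {K L : Type*} [Field K] [LieRing L] [LieAlgebra K L]

theorem lie_mem_lowerCentralSeries_succ (x : L) {y : L} {k : ℕ}
    (hy : y ∈ lowerCentralSeries K L L k) : ⁅x, y⁆ ∈ lowerCentralSeries K L L (k + 1) := by
  rw [lowerCentralSeries_succ]
  exact LieSubmodule.lie_mem_lie (LieSubmodule.mem_top x) hy

theorem lie_mem_lowerCentralSeries_one (x y : L) : ⁅x, y⁆ ∈ lowerCentralSeries K L L 1 :=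
  lie_mem_lowerCentralSeries_succ x (by simp)

theorem lowerCentralSeries_succ_le {k : ℕ} {N : Submodule K L}
    (h : ∀ x : L, ∀ y ∈ lowerCentralSeries K L L k, ⁅x, y⁆ ∈ N) :
    (lowerCentralSeries K L L (k + 1)).toSubmodule ≤ N := by
  rw [lowerCentralSeries_succ, LieSubmodule.lieIdeal_oper_eq_linear_span', Submodule.span_le]
  rintro _ ⟨x, -, y, hy, rfl⟩
  exact h x y hy

theorem map_mem_lowerCentralSeries {f : End K L} (hf : ∀ x y, f ⁅x, y⁆ = ⁅f x, f y⁆) (k : ℕ) :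
    ∀ x ∈ lowerCentralSeries K L L k, f x ∈ lowerCentralSeries K L L k := by
  induction k with
  | zero => simp
  | succ k ih =>
    refine lowerCentralSeries_succ_le
      (N := (lowerCentralSeries K L L (k + 1)).toSubmodule.comap f) fun x y hy => ?_
    rw [Submodule.mem_comap, hf]
    exact lie_mem_lowerCentralSeries_succ _ (ih y hy)

theorem lie_eq_zero_of_mem_lowerCentralSeries_two (h3 : lowerCentralSeries K L L 3 = ⊥) (x : L)
    {z : L} (hz : z ∈ lowerCentralSeries K L L 2) : ⁅x, z⁆ = 0 := by
  have h := lie_mem_lowerCentralSeries_succ x hz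
  rwa [h3, LieSubmodule.mem_bot] at h

/-- In nilpotency class at most three the derived algebra is abelian. -/
theorem lie_eq_zero_of_mem_lowerCentralSeries_one (h3 : lowerCentralSeries K L L 3 = ⊥) {x y : L}
    (hx : x ∈ lowerCentralSeries K L L 1) (hy : y ∈ lowerCentralSeries K L L 1) :
    ⁅x, y⁆ = 0 := by
  have h0 := fun a z hz => lie_eq_zero_of_mem_lowerCentralSeries_two (L := L) h3 a (z := z) hz
  have hy2 : ∀ a, ⁅y, a⁆ ∈ lowerCentralSeries K L L 2 := fun a => by
    rw [← lie_skew]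
    exact neg_mem (lie_mem_lowerCentralSeries_succ a hy)
  have := lowerCentralSeries_succ_le (k := 0) (N := LinearMap.ker (LieAlgebra.ad K L y : End K L))
    (fun a b _ => ?_) hx
  · rw [← lie_skew, neg_eq_zero]
    exact this
  · rw [LinearMap.mem_ker]
    change ⁅y, ⁅a, b⁆⁆ = 0
    rw [leibniz_lie, ← lie_skew, h0 b _ (hy2 a), h0 a _ (hy2 b), neg_zero, add_zero]

end LowerCentralSeries

/-! ### Frames of eigenvectors and the case where all pairs are connected -/

section Frame

variable {F M : Type*} [Field F] [LieRing M] [LieAlgebra F M]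

/-- A frame of `γ₂(M)` adapted to an endomorphism `f`: a basis `Z` of `γ₃(M)` made of eigenvectors
for distinct eigenvalues `ν i`, and two generalized eigenvectors `Y` for distinct eigenvalues `μ j`
which form a basis of `γ₂(M)` modulo `γ₃(M)`. -/
structure EigenFrame (f : End F M) (n : ℕ) where
  /-- The eigenvalues on `γ₃(M)`. -/
  ν : Fin n → F
  /-- The eigenvalues on `γ₂(M) / γ₃(M)`. -/
  μ : Fin 2 → F
  /-- The basis of `γ₃(M)`. -/
  Z : Fin n → M
  /-- The basis of `γ₂(M)` modulo `γ₃(M)`. -/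
  Y : Fin 2 → M
  ν_inj : Function.Injective ν
  μ_inj : Function.Injective μ
  Z_eigen : ∀ i, f (Z i) = ν i • Z i
  Z_indep : LinearIndependent F Z
  Z_span : Submodule.span F (Set.range Z) = (lowerCentralSeries F M M 2).toSubmodule
  Y_mem : ∀ j, Y j ∈ lowerCentralSeries F M M 1
  Y_eigen : ∀ j, f (Y j) - μ j • Y j ∈ lowerCentralSeries F M M 2
  Y_gen : ∀ j, Y j ∈ f.maxGenEigenspace (μ j)
  Y_span : ∀ y ∈ lowerCentralSeries F M M 1, ∃ c : Fin 2 → F,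
    y - ∑ j, c j • Y j ∈ lowerCentralSeries F M M 2
  Y_indep : ∀ c : Fin 2 → F, ∑ j, c j • Y j ∈ lowerCentralSeries F M M 2 → c = 0

namespace EigenFrame

variable {f : End F M} {n : ℕ} (E : EigenFrame f n)

include E

theorem Z_mem (i : Fin n) : E.Z i ∈ lowerCentralSeries F M M 2 := by
  have : E.Z i ∈ Submodule.span F (Set.range E.Z) := Submodule.subset_span ⟨i, rfl⟩
  rwa [E.Z_span] at this

theorem Z_ne_zero (i : Fin n) : E.Z i ≠ 0 := E.Z_indep.ne_zero i

theorem Y_notMem (j : Fin 2) : E.Y j ∉ lowerCentralSeries F M M 2 := by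
  intro h
  have := E.Y_indep (Pi.single j 1) (by simpa [Pi.single_apply] using h)
  simpa using congrFun this j

theorem exists_coord_Z {z : M} (hz : z ∈ lowerCentralSeries F M M 2) :
    ∃ c : Fin n → F, z = ∑ i, c i • E.Z i := by
  have : z ∈ Submodule.span F (Set.range E.Z) := by rwa [E.Z_span]
  obtain ⟨c, hc⟩ := (Submodule.mem_span_range_iff_exists_fun F).1 this
  exact ⟨c, hc.symm⟩

theorem exists_coord_Y {y : M} (hy : y ∈ lowerCentralSeries F M M 1) :
    ∃ c : Fin 2 → F, ∃ z ∈ lowerCentralSeries F M M 2, y = ∑ j, c j • E.Y j + z := by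
  obtain ⟨c, hc⟩ := E.Y_span y hy
  exact ⟨c, _, hc, by abel⟩

theorem Z_notMem_span (i : Fin n) : E.Z i ∉ Submodule.span F (E.Z '' {i}ᶜ) :=
  E.Z_indep.notMem_span_image (by simp)

theorem Z_mem_span {i k : Fin n} (h : k ≠ i) : E.Z k ∈ Submodule.span F (E.Z '' {i}ᶜ) :=
  Submodule.subset_span ⟨k, by simpa using h, rfl⟩

/-- A generalized eigenvector in `γ₃` only involves those `Z i` with the same eigenvalue. -/
theorem ν_eq_of_coord {a : F} {c : Fin n → F}
    (h : ∑ i, c i • E.Z i ∈ f.maxGenEigenspace a) {i : Fin n} (hi : c i ≠ 0) : E.ν i = a := by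
  rw [End.mem_maxGenEigenspace] at h
  obtain ⟨k, hk⟩ := h
  have hpow : ∀ k : ℕ, ∀ i, ((f - a • 1) ^ k) (E.Z i) = (E.ν i - a) ^ k • E.Z i := by
    intro k i
    induction k with
    | zero => simp
    | succ k ih =>
      rw [pow_succ', End.mul_apply, ih]
      simp only [map_smul, LinearMap.sub_apply, LinearMap.smul_apply, End.one_apply, E.Z_eigen,
        pow_succ]
      module
  simp only [map_sum, map_smul, hpow, smul_smul] at hk
  have := Fintype.linearIndependent_iff.1 E.Z_indep _ hk i
  exact sub_eq_zero.1 (eq_zero_of_pow_eq_zero ((mul_eq_zero.1 this).resolve_left hi))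

theorem exists_eq_smul_Z {a : F} {z : M} (hz : z ∈ lowerCentralSeries F M M 2)
    (ha : z ∈ f.maxGenEigenspace a) (h0 : z ≠ 0) :
    ∃ i, ∃ c : F, E.ν i = a ∧ c ≠ 0 ∧ z = c • E.Z i := by
  obtain ⟨c, rfl⟩ := E.exists_coord_Z hz
  obtain ⟨i, -, hi⟩ := Finset.exists_ne_zero_of_sum_ne_zero h0
  have hci : c i ≠ 0 := fun h => hi (by simp [h])
  have hνi := E.ν_eq_of_coord ha hci
  refine ⟨i, c i, hνi, hci, ?_⟩
  refine Finset.sum_eq_single i (fun k _ hk => ?_) (by simp)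
  by_contra h
  have hck : c k ≠ 0 := fun h' => h (by simp [h'])
  exact hk (E.ν_inj ((E.ν_eq_of_coord ha hck).trans hνi.symm))

/-- Modulo `γ₃`, a generalized eigenvector in `γ₂` only involves those `Y j` with the same
eigenvalue. -/
theorem μ_eq_of_coord {a : F} {c : Fin 2 → F} {z : M} (hf : ∀ x y, f ⁅x, y⁆ = ⁅f x, f y⁆)
    (hz : z ∈ lowerCentralSeries F M M 2)
    (h : ∑ j, c j • E.Y j + z ∈ f.maxGenEigenspace a) {j : Fin 2} (hj : c j ≠ 0) : E.μ j = a := by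
  rw [End.mem_maxGenEigenspace] at h
  obtain ⟨k, hk⟩ := h
  set G := (lowerCentralSeries F M M 2).toSubmodule
  have hG : ∀ x ∈ G, (f - a • 1) x ∈ G := fun x hx => by
    simpa using G.sub_mem (map_mem_lowerCentralSeries hf 2 x hx) (G.smul_mem a hx)
  have hGk : ∀ k : ℕ, ∀ x ∈ G, ((f - a • 1) ^ k) x ∈ G := by
    intro k
    induction k with
    | zero => simp
    | succ k ih => intro x hx; rw [pow_succ, End.mul_apply]; exact ih _ (hG x hx)
  have hpow : ∀ k : ℕ, ∀ j, ((f - a • 1) ^ k) (E.Y j) - (E.μ j - a) ^ k • E.Y j ∈ G := by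
    intro k j
    induction k with
    | zero => simp
    | succ k ih =>
      have h1 := G.smul_mem ((E.μ j - a) ^ k) (E.Y_eigen j)
      have h2 := G.add_mem (hG _ ih) h1
      refine (congrArg (· ∈ G) ?_).mp h2
      rw [pow_succ', End.mul_apply]
      simp only [map_sub, map_smul, LinearMap.sub_apply, LinearMap.smul_apply, End.one_apply,
        pow_succ]
      module
  have hsum : ∑ j, (c j * (E.μ j - a) ^ k) • E.Y j ∈ G := by
    have h1 : ∑ j, c j • (((f - a • 1) ^ k) (E.Y j) - (E.μ j - a) ^ k • E.Y j) ∈ G :=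
      G.sum_mem fun j _ => G.smul_mem _ (hpow k j)
    have h2 := G.add_mem h1 (hGk k z hz)
    rw [map_add, map_sum] at hk
    simp only [map_smul, Fin.sum_univ_two] at hk h2 ⊢
    have h3 := G.neg_mem h2
    refine (congrArg (· ∈ G) ?_).mp h3
    rw [← sub_eq_zero, ← neg_eq_zero, ← hk]
    module
  have := congrFun (E.Y_indep _ hsum) j
  have h0 : E.μ j - a = 0 := by
    have h1 : c j * (E.μ j - a) ^ k = 0 := this
    exact eq_zero_of_pow_eq_zero ((mul_eq_zero.1 h1).resolve_left hj)
  exact sub_eq_zero.1 h0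

theorem lie_coord (h3 : lowerCentralSeries F M M 3 = ⊥) {x w : M} {j : Fin 2}
    (hx : ∀ j', ⁅x, E.Y j'⁆ = if j = j' then w else 0) (c : Fin 2 → F) {z : M}
    (hz : z ∈ lowerCentralSeries F M M 2) : ⁅x, ∑ j, c j • E.Y j + z⁆ = c j • w := by
  simp only [lie_add, lie_sum, lie_smul, hx, lie_eq_zero_of_mem_lowerCentralSeries_two h3 x hz,
    add_zero, smul_ite, smul_zero, Finset.sum_ite_eq, Finset.mem_univ, if_true]

theorem lie_eq_zero_of_forall_Y (h3 : lowerCentralSeries F M M 3 = ⊥) {x : M}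
    (hx : ∀ j, ⁅x, E.Y j⁆ = 0) : ∀ y ∈ lowerCentralSeries F M M 1, ⁅x, y⁆ = 0 := by
  intro y hy
  obtain ⟨c, z, hz, rfl⟩ := E.exists_coord_Y hy
  rw [E.lie_coord h3 (j := 0) (w := 0) (by simpa using hx) c hz, smul_zero]

/-- Brackets that land in the span of the `Z k`, `k ≠ i`, detect vanishing coordinates. -/
theorem coord_eq_zero (h3 : lowerCentralSeries F M M 3 = ⊥) {x : M} {i : Fin n} {j : Fin 2}
    (hx : ∀ j', ⁅x, E.Y j'⁆ = if j = j' then E.Z i else 0) {c : Fin 2 → F} {z : M}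
    (hz : z ∈ lowerCentralSeries F M M 2)
    (h : ⁅x, ∑ j, c j • E.Y j + z⁆ ∈ Submodule.span F (E.Z '' {i}ᶜ)) : c j = 0 := by
  by_contra hc
  rw [E.lie_coord h3 hx c hz] at h
  exact E.Z_notMem_span i ((Submodule.smul_mem_iff _ hc).1 h)

/-- There is no class three algebra in which every `Z i ⊗ (Y j)*` is realized by a bracket,
provided brackets `⁅X i j, X k l⁆` with `i ≠ k` vanish modulo `γ₃` whenever no third index
is available: the Jacobi identity forces `γ₂ ≤ γ₃`. -/
theorem false_of_forall_pairs (h3 : lowerCentralSeries F M M 3 = ⊥) (hn : 2 ≤ n)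
    {X : Fin n → Fin 2 → M}
    (hX : ∀ i j j', ⁅X i j, E.Y j'⁆ = if j = j' then E.Z i else 0)
    (hXX : ∀ i j k l, i ≠ k → (∃ m, m ≠ i ∧ m ≠ k) ∨
      ⁅X i j, X k l⁆ ∈ lowerCentralSeries F M M 2) : False := by
  set G := lowerCentralSeries F M M 2
  have h0 : ∀ a, ∀ z ∈ G, ⁅a, z⁆ = 0 := fun a z hz =>
    lie_eq_zero_of_mem_lowerCentralSeries_two h3 a hz
  have hne : ∀ i : Fin n, ∃ m, m ≠ i := fun i =>
    haveI : Nontrivial (Fin n) := Fin.nontrivial_iff_two_le.2 hn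
    exists_ne i
  have hXG : ∀ i j, ∀ y ∈ lowerCentralSeries F M M 1, ∃ c : F, ⁅X i j, y⁆ = c • E.Z i := by
    intro i j y hy
    obtain ⟨c, z, hz, rfl⟩ := E.exists_coord_Y hy
    exact ⟨c j, E.lie_coord h3 (hX i j) c hz⟩
  -- `y ∈ γ₂` lies in `γ₃` as soon as some row `X i` maps it into the span of the other `Z k`
  have key : ∀ y ∈ lowerCentralSeries F M M 1,
      (∃ i, ∀ j, ⁅X i j, y⁆ ∈ Submodule.span F (E.Z '' {i}ᶜ)) → y ∈ G := by
    rintro y hy ⟨i, hi⟩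
    obtain ⟨c, z, hz, rfl⟩ := E.exists_coord_Y hy
    have : c = 0 := funext fun j => E.coord_eq_zero h3 (hX i j) hz (hi j)
    rw [this]
    simpa only [Pi.zero_apply, zero_smul, Finset.sum_const_zero, zero_add] using hz
  have hXX' : ∀ i j k l, ⁅X i j, X k l⁆ ∈ G := by
    intro i j k l
    have h1 : (∃ m, m ≠ i ∧ m ≠ k) ∨ ⁅X i j, X k l⁆ ∈ G := by
      by_cases hik : i = k
      · obtain ⟨m, hm⟩ := hne i
        exact Or.inl ⟨m, hm, hik ▸ hm⟩
      · exact hXX i j k l hik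
    -- by the Jacobi identity `X m p` maps `⁅X i j, X k l⁆` into the span of `Z i` and `Z k`
    obtain ⟨m, hmi, hmk⟩ | h1 := h1
    · refine key _ (lie_mem_lowerCentralSeries_one _ _) ⟨m, fun p => ?_⟩
      obtain ⟨a, ha⟩ := hXG i j _ (lie_mem_lowerCentralSeries_one (X m p) (X k l))
      obtain ⟨b, hb⟩ := hXG k l _ (lie_mem_lowerCentralSeries_one (X m p) (X i j))
      rw [leibniz_lie, ha, ← lie_skew, hb]
      exact Submodule.add_mem _ (Submodule.neg_mem _ (Submodule.smul_mem _ _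
        (E.Z_mem_span hmk.symm))) (Submodule.smul_mem _ _ (E.Z_mem_span hmi.symm))
    · exact h1
  have hXu : ∀ u : M, (∀ y ∈ lowerCentralSeries F M M 1, ⁅u, y⁆ = 0) → ∀ k l, ⁅X k l, u⁆ ∈ G := by
    intro u hu k l
    obtain ⟨i, hi⟩ := hne k
    refine key _ (lie_mem_lowerCentralSeries_one _ _) ⟨i, fun j => ?_⟩
    obtain ⟨c, hc⟩ := hXG k l _ (lie_mem_lowerCentralSeries_one (X i j) u)
    rw [leibniz_lie, hc, ← lie_skew, hu _ (lie_mem_lowerCentralSeries_one _ _), neg_zero, zero_add]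
    exact Submodule.smul_mem _ _ (E.Z_mem_span hi.symm)
  have huu : ∀ u v : M, (∀ y ∈ lowerCentralSeries F M M 1, ⁅u, y⁆ = 0) →
      (∀ y ∈ lowerCentralSeries F M M 1, ⁅v, y⁆ = 0) → ⁅u, v⁆ ∈ G := by
    intro u v hu hv
    refine key _ (lie_mem_lowerCentralSeries_one _ _) ⟨⟨0, by omega⟩, fun j => ?_⟩
    rw [leibniz_lie, ← lie_skew, hv _ (lie_mem_lowerCentralSeries_one _ _),
      hu _ (lie_mem_lowerCentralSeries_one _ _)]
    simp
  -- `M` is spanned by the `X i j` and the centralizer of `γ₂`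
  have hdec : ∀ x : M, ∃ c : Fin n → Fin 2 → F, ∃ u,
      (∀ y ∈ lowerCentralSeries F M M 1, ⁅u, y⁆ = 0) ∧ x = ∑ i, ∑ j, c i j • X i j + u := by
    intro x
    choose c hc using fun j =>
      E.exists_coord_Z (lie_mem_lowerCentralSeries_succ x (E.Y_mem j))
    refine ⟨fun i j => c j i, x - ∑ i, ∑ j, c j i • X i j,
      E.lie_eq_zero_of_forall_Y h3 fun j' => ?_, by abel⟩
    simp only [sub_lie, sum_lie, smul_lie, hX, hc, smul_ite, smul_zero, Finset.sum_ite_eq',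
      Finset.mem_univ, if_true, sub_self]
  have hall : ∀ x y : M, ⁅x, y⁆ ∈ G := by
    intro x y
    obtain ⟨c, u, hu, rfl⟩ := hdec x
    obtain ⟨d, v, hv, rfl⟩ := hdec y
    have h1 : ∀ i j, ⁅X i j, ∑ i, ∑ j, d i j • X i j + v⁆ ∈ G := fun i j => by
      simp only [lie_add, lie_sum, lie_smul]
      exact G.add_mem (G.sum_mem fun k _ => G.sum_mem fun l _ => G.smul_mem _ (hXX' i j k l))
        (hXu v hv i j)
    have h2 : ⁅u, ∑ i, ∑ j, d i j • X i j + v⁆ ∈ G := by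
      simp only [lie_add, lie_sum, lie_smul]
      refine G.add_mem (G.sum_mem fun k _ => G.sum_mem fun l _ => G.smul_mem _ ?_) (huu u v hu hv)
      rw [← lie_skew]
      exact G.neg_mem (hXu u hu k l)
    rw [add_lie]
    simp only [sum_lie, smul_lie]
    exact G.add_mem (G.sum_mem fun k _ => G.sum_mem fun l _ => G.smul_mem _ (h1 k l)) h2
  exact E.Y_notMem 0 (lowerCentralSeries_succ_le (k := 0) (N := G.toSubmodule)
    (fun x y _ => hall x y) (E.Y_mem 0))

end EigenFrame

end Frame

/-! ### The centralizer of `γ₂` and the derived core -/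

section DerivedCore

variable (K L : Type*) [Field K] [LieRing L] [LieAlgebra K L]

/-- The centralizer of `γ₂(L)` in `L`. -/
def derivedCentralizer : Submodule K L where
  carrier := {u | ∀ y ∈ lowerCentralSeries K L L 1, ⁅u, y⁆ = 0}
  add_mem' hu hv y hy := by rw [add_lie, hu y hy, hv y hy, add_zero]
  zero_mem' y _ := zero_lie y
  smul_mem' c u hu y hy := by rw [smul_lie, hu y hy, smul_zero]

/-- The elements which centralize `γ₂(L)` and are central modulo `γ₃(L)`. -/
def derivedCore : Submodule K L where
  carrier := {u | u ∈ derivedCentralizer K L ∧ ∀ x : L, ⁅x, u⁆ ∈ lowerCentralSeries K L L 2}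
  add_mem' hu hv := ⟨add_mem hu.1 hv.1, fun x => by
    rw [lie_add]; exact add_mem (hu.2 x) (hv.2 x)⟩
  zero_mem' := ⟨zero_mem _, fun x => by rw [lie_zero]; exact zero_mem _⟩
  smul_mem' c u hu := ⟨Submodule.smul_mem _ c hu.1, fun x => by
    rw [lie_smul]; exact SMulMemClass.smul_mem c (hu.2 x)⟩

variable {K L}

theorem mem_derivedCore_of_mem_lowerCentralSeries_one (h3 : lowerCentralSeries K L L 3 = ⊥) {y : L}
    (hy : y ∈ lowerCentralSeries K L L 1) : y ∈ derivedCore K L :=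
  ⟨fun _ hz => lie_eq_zero_of_mem_lowerCentralSeries_one h3 hy hz,
    fun x => lie_mem_lowerCentralSeries_succ x hy⟩

theorem lowerCentralSeries_two_le_one {y : L} (hy : y ∈ lowerCentralSeries K L L 2) :
    y ∈ lowerCentralSeries K L L 1 :=
  antitone_lowerCentralSeries K L L one_le_two hy

theorem map_mem_derivedCentralizer {f : End K L} (hf : ∀ x y, f ⁅x, y⁆ = ⁅f x, f y⁆)
    (hsurj : Function.Surjective f) {u : L} (hu : u ∈ derivedCentralizer K L) :
    f u ∈ derivedCentralizer K L := by
  intro y hy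
  have h := lowerCentralSeries_succ_le (k := 0)
    (N := (lowerCentralSeries K L L 1).toSubmodule.map f) (fun a b _ => ?_) hy
  · obtain ⟨y', hy', rfl⟩ := h
    rw [← hf, hu y' hy', map_zero]
  · obtain ⟨a, rfl⟩ := hsurj a
    obtain ⟨b, rfl⟩ := hsurj b
    exact ⟨⁅a, b⁆, lie_mem_lowerCentralSeries_one a b, hf a b⟩

end DerivedCore

/-! ### Partners of the connecting elements in the centralizer of `γ₂` -/

namespace EigenFrame

variable {F M : Type*} [Field F] [LieRing M] [LieAlgebra F M] {f : End F M}

section TwoTwo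

variable (E : EigenFrame f 2)

include E

/-- Suppose that the only brackets between `M` and `γ₂` are `⁅X i, Y i⁆ = Z i`, and that the `X i`
commute. Then the bracket with `X i` only produces multiples of `Y i`, modulo `γ₃`. -/
theorem exists_lie_X_eq (h3 : lowerCentralSeries F M M 3 = ⊥) {X : Fin 2 → M}
    (hX : ∀ i j, ⁅X i, E.Y j⁆ = if i = j then E.Z i else 0) (hXX : ∀ i k, ⁅X i, X k⁆ = 0)
    (u : M) (i : Fin 2) :
    ∃ c : F, ∃ z ∈ lowerCentralSeries F M M 2, ⁅X i, u⁆ = c • E.Y i + z := by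
  obtain ⟨c, z, hz, hc⟩ := E.exists_coord_Y (lie_mem_lowerCentralSeries_one (X i) u)
  refine ⟨c i, z, hz, ?_⟩
  have hk : ∀ k, k ≠ i → c k = 0 := by
    intro k hk
    refine E.coord_eq_zero h3 (hX k) hz ?_
    obtain ⟨d, w, hw, hd⟩ := E.exists_coord_Y (lie_mem_lowerCentralSeries_one (X k) u)
    rw [← hc, leibniz_lie, hXX, zero_lie, zero_add, hd, E.lie_coord h3 (hX i) d hw]
    exact Submodule.smul_mem _ _ (E.Z_mem_span hk.symm)
  rw [hc, Finset.sum_eq_single i (fun k _ h => by rw [hk k h, zero_smul]) (by simp)]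

theorem lie_mem_of_mem_derivedCentralizer (h3 : lowerCentralSeries F M M 3 = ⊥) {X : Fin 2 → M}
    (hX : ∀ i j, ⁅X i, E.Y j⁆ = if i = j then E.Z i else 0)
    {u v : M} (hu : u ∈ derivedCentralizer F M) (hv : v ∈ derivedCentralizer F M) :
    ⁅u, v⁆ ∈ lowerCentralSeries F M M 2 := by
  obtain ⟨c, z, hz, hc⟩ := E.exists_coord_Y (lie_mem_lowerCentralSeries_one u v)
  have : c = 0 := funext fun j => by
    refine E.coord_eq_zero h3 (hX j) hz ?_
    rw [← hc, leibniz_lie, ← lie_skew, hv _ (lie_mem_lowerCentralSeries_one _ _),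
      hu _ (lie_mem_lowerCentralSeries_one _ _), neg_zero, add_zero]
    exact zero_mem _
  rw [hc, this]
  simpa only [Pi.zero_apply, zero_smul, Finset.sum_const_zero, zero_add] using hz

/-- Some `u` in the centralizer of `γ₂` satisfies `⁅X i, u⁆ ∉ γ₃`, since otherwise `Y i` would not
be a combination of brackets. -/
theorem exists_lie_X_notMem (h3 : lowerCentralSeries F M M 3 = ⊥) {X : Fin 2 → M}
    (hX : ∀ i j, ⁅X i, E.Y j⁆ = if i = j then E.Z i else 0) (hXX : ∀ i k, ⁅X i, X k⁆ = 0)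
    (hdec : ∀ x, ∃ c : Fin 2 → F, x - ∑ i, c i • X i ∈ derivedCentralizer F M) (i : Fin 2) :
    ∃ u ∈ derivedCentralizer F M, ⁅X i, u⁆ ∉ lowerCentralSeries F M M 2 := by
  by_contra! hcon
  set G := (lowerCentralSeries F M M 2).toSubmodule
  -- every bracket would lie in the span `T` of `γ₃` and the other `Y k`
  set T := Submodule.span F (E.Y '' {i}ᶜ) ⊔ G with hT
  have hGT : G ≤ T := le_sup_right
  have hXT : ∀ k, ∀ u ∈ derivedCentralizer F M, ⁅X k, u⁆ ∈ T := by
    intro k u hu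
    by_cases hk : k = i
    · exact hGT (hk ▸ hcon u hu)
    · obtain ⟨c, z, hz, h⟩ := E.exists_lie_X_eq h3 hX hXX u k
      rw [h]
      exact add_mem (le_sup_left (a := Submodule.span F (E.Y '' {i}ᶜ))
        (Submodule.smul_mem _ _ (Submodule.subset_span ⟨k, hk, rfl⟩))) (hGT hz)
  have hall : ∀ x y : M, ⁅x, y⁆ ∈ T := by
    intro x y
    obtain ⟨c, hu⟩ := hdec x
    obtain ⟨d, hv⟩ := hdec y
    set u := x - ∑ i, c i • X i
    set v := y - ∑ i, d i • X i
    have hx : x = ∑ i, c i • X i + u := by simp [u]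
    have hy : y = ∑ i, d i • X i + v := by simp [v]
    rw [hx, hy]
    simp only [add_lie, lie_add, sum_lie, lie_sum, smul_lie, lie_smul, hXX, smul_zero,
      Finset.sum_const_zero, zero_add]
    refine add_mem ?_ (add_mem ?_ (hGT (E.lie_mem_of_mem_derivedCentralizer h3 hX hu hv)))
    · refine Submodule.sum_mem _ fun k _ => Submodule.smul_mem _ _ ?_
      rw [← lie_skew]
      exact Submodule.neg_mem _ (hXT k u hu)
    · refine Submodule.sum_mem _ fun k _ => Submodule.smul_mem _ _ (hXT k v hv)
  have hY : E.Y i ∈ T := lowerCentralSeries_succ_le (k := 0) (fun x y _ => hall x y) (E.Y_mem i)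
  obtain ⟨s, hs, g, hg, hsg⟩ := Submodule.mem_sup.1 hY
  obtain ⟨k, hk⟩ : ∃ k : Fin 2, {i}ᶜ = ({k} : Set (Fin 2)) ∧ k ≠ i := by
    fin_cases i
    · exact ⟨1, by ext j; fin_cases j <;> simp, by simp⟩
    · exact ⟨0, by ext j; fin_cases j <;> simp, by simp⟩
  rw [hk.1, Set.image_singleton] at hs
  obtain ⟨a, rfl⟩ := Submodule.mem_span_singleton.1 hs
  have h0 := E.Y_indep (Pi.single i 1 - Pi.single k a) (by
    have h1 : ∑ j, (Pi.single i 1 - Pi.single k a : Fin 2 → F) j • E.Y j = g := by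
      simp only [Pi.sub_apply, sub_smul, Finset.sum_sub_distrib]
      rw [Finset.sum_eq_single i (fun j _ h => by rw [Pi.single_eq_of_ne h, zero_smul]) (by simp),
        Finset.sum_eq_single k (fun j _ h => by rw [Pi.single_eq_of_ne h, zero_smul]) (by simp),
        Pi.single_eq_same, Pi.single_eq_same, one_smul, ← hsg]
      abel
    rw [h1]; exact hg)
  have := congrFun h0 i
  simp [hk.2.symm] at this

/-- The eigenvalue bookkeeping in type `(6, 2, 2)`: generalized eigenvectors `U i` in the
centralizer of `γ₂` may be chosen such that the brackets among the `X i` and `U i` vanish except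
for `⁅X i, U i⁆`, which is a nonzero multiple of `Y i` modulo `γ₃`. -/
theorem exists_partners [IsAlgClosed F] [FiniteDimensional F M]
    (hf : ∀ x y, f ⁅x, y⁆ = ⁅f x, f y⁆) (hsurj : Function.Surjective f)
    (hroot : ∀ a, f.HasEigenvalue a → ∀ m : ℕ, 0 < m → a ^ m ≠ 1)
    (h3 : lowerCentralSeries F M M 3 = ⊥)
    (hμ : ∀ i k, i ≠ k → (E.μ i * E.μ k) ^ 2 = 1) (hν : ∀ i k, i ≠ k → (E.ν i * E.ν k) ^ 2 = 1)
    {l : Fin 2 → F} (hl : ∀ i, l i * E.μ i = E.ν i)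
    {X : Fin 2 → M} (hXl : ∀ i, X i ∈ f.maxGenEigenspace (l i))
    (hX : ∀ i j, ⁅X i, E.Y j⁆ = if i = j then E.Z i else 0)
    (hdec : ∀ x, ∃ c : Fin 2 → F, x - ∑ i, c i • X i ∈ derivedCentralizer F M) :
    (∀ i k, ⁅X i, X k⁆ = 0) ∧ ∃ U : Fin 2 → M, ∃ a : Fin 2 → F,
      (∀ i, U i ∈ derivedCentralizer F M) ∧ (∀ i k, ⁅U i, U k⁆ = 0) ∧
      (∀ i k, i ≠ k → ⁅X i, U k⁆ = 0) ∧ (∀ i, a i ≠ 0) ∧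
      ∀ i, ⁅X i, U i⁆ - a i • E.Y i ∈ lowerCentralSeries F M M 2 := by
  have hvanish : ∀ {a : F} {x : M} (m : ℕ), 0 < m → a ^ m = 1 → x ∈ f.maxGenEigenspace a →
      x = 0 := fun m hm ha hx => by
    by_contra h0
    exact hroot _ (hasEigenvalue_of_mem_maxGenEigenspace hx h0) m hm ha
  have hother : ∀ i : Fin 2, ∃ k, k ≠ i := exists_ne
  have hμ0 : ∀ i, E.μ i ≠ 0 := fun i h => by
    obtain ⟨k, hk⟩ := hother i
    simpa [h] using hμ i k hk.symm
  have hll : ∀ i k, i ≠ k → (l i * l k) ^ 2 = 1 := fun i k hik => by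
    have h1 := hν i k hik
    rw [← hl, ← hl] at h1
    linear_combination h1 - (l i * l k) ^ 2 * hμ i k hik
  have hl0 : ∀ i, l i ≠ 0 := fun i h => by
    obtain ⟨k, hk⟩ := hother i
    simpa [h] using hll i k hk.symm
  -- `⁅X 0, X 1⁆` would have the eigenvalue `l 0 * l 1`, a root of unity
  have hXX : ∀ i k, ⁅X i, X k⁆ = 0 := fun i k => by
    by_cases hik : i = k
    · rw [hik, lie_self]
    · exact hvanish 2 two_pos (hll i k hik) (lie_mem_maxGenEigenspace hf (hXl i) (hXl k))
  refine ⟨hXX, ?_⟩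
  have hU : ∀ i, ∃ s : F, ∃ u ∈ derivedCentralizer F M, u ∈ f.maxGenEigenspace s ∧
      ⁅X i, u⁆ ∉ lowerCentralSeries F M M 2 := by
    intro i
    by_contra! hcon
    obtain ⟨u, hu, hXu⟩ := E.exists_lie_X_notMem h3 hX hXX hdec i
    have h1 := Submodule.eq_iSup_inf_genEigenspace (p := derivedCentralizer F M) (f := f) ⊤
      (fun x hx => map_mem_derivedCentralizer hf hsurj hx) (End.iSup_maxGenEigenspace_eq_top f)
    have h2 : derivedCentralizer F M ≤
        (lowerCentralSeries F M M 2).toSubmodule.comap (LieAlgebra.ad F M (X i) : End F M) := by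
      rw [h1]
      exact iSup_le fun s v hv => hcon s v hv.1 hv.2
    exact hXu (h2 hu)
  choose s U hUC hUs hXU using hU
  -- the eigenvalue of `U i` is `μ i / l i`
  have hcoef : ∀ i k, ⁅X i, U k⁆ ∉ lowerCentralSeries F M M 2 → l i * s k = E.μ i := by
    intro i k hik
    obtain ⟨c, z, hz, hc⟩ := E.exists_lie_X_eq h3 hX hXX (U k) i
    have hc0 : c ≠ 0 := fun h => hik (by rw [hc, h, zero_smul, zero_add]; exact hz)
    have h1 := lie_mem_maxGenEigenspace hf (hXl i) (hUs k)
    have h2 : ∑ j, (Pi.single i c : Fin 2 → F) j • E.Y j + z ∈ f.maxGenEigenspace (l i * s k) := by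
      rw [Finset.sum_eq_single i (fun j _ h => by rw [Pi.single_eq_of_ne h, zero_smul]) (by simp),
        Pi.single_eq_same, ← hc]
      exact h1
    exact (E.μ_eq_of_coord hf hz h2 (j := i) (by simpa using hc0)).symm
  have hls : ∀ i, l i * s i = E.μ i := fun i => hcoef i i (hXU i)
  have hss : ∀ i k, i ≠ k → (s i * s k) ^ 2 = 1 := fun i k hik => by
    have h1 := hμ i k hik
    rw [← hls, ← hls] at h1
    linear_combination h1 - (s i * s k) ^ 2 * hll i k hik
  have hUU : ∀ i k, ⁅U i, U k⁆ = 0 := fun i k => by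
    by_cases hik : i = k
    · rw [hik, lie_self]
    · exact hvanish 2 two_pos (hss i k hik) (lie_mem_maxGenEigenspace hf (hUs i) (hUs k))
  have hU0 : ∀ i, U i ≠ 0 := fun i h => hXU i (by rw [h, lie_zero]; exact zero_mem _)
  -- off the diagonal the brackets lie in `γ₃`, and only `Z i` has an admissible eigenvalue
  have hoff : ∀ i k, i ≠ k → ∃ d : F, ⁅X i, U k⁆ = d • E.Z i := by
    intro i k hik
    by_cases h0 : ⁅X i, U k⁆ = 0
    · exact ⟨0, by rw [h0, zero_smul]⟩
    have hmem : ⁅X i, U k⁆ ∈ lowerCentralSeries F M M 2 := by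
      by_contra h
      have h1 : s i = s k := mul_left_cancel₀ (hl0 i) ((hls i).trans (hcoef i k h).symm)
      refine hU0 i (hvanish 4 (by norm_num) ?_ (hUs i))
      have h2 := hss i k hik
      rw [← h1] at h2
      linear_combination h2
    obtain ⟨j, c, hj, -, hc⟩ := E.exists_eq_smul_Z hmem
      (lie_mem_maxGenEigenspace hf (hXl i) (hUs k)) h0
    by_cases hji : j = i
    · exact ⟨c, hji ▸ hc⟩
    · -- the other eigenvalue is excluded: it forces `l k ^ 2 = l i`, so that `l k` is a root of unity
      exfalso
      have hjk : j = k := by omega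
      subst hjk
      rw [← hl, ← hls] at hj
      have hs0 : s j ≠ 0 := fun h => hμ0 j (by rw [← hls, h, mul_zero])
      have h1 : l j ^ 2 = l i := mul_right_cancel₀ hs0 (by linear_combination hj)
      have hXj : X j ≠ 0 := fun h => E.Z_ne_zero j (by simpa [h] using (hX j j).symm)
      refine hXj (hvanish 6 (by norm_num) ?_ (hXl j))
      have h2 := hll i j hik
      rw [← h1] at h2
      linear_combination h2
  choose c z hz hc using fun i => E.exists_lie_X_eq h3 hX hXX (U i) i
  have hc0 : ∀ i, c i ≠ 0 := fun i h => hXU i (by rw [hc, h, zero_smul, zero_add]; exact hz i)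
  have hXW : ∀ i k, ⁅X i, ⁅X k, U k⁆⁆ = if k = i then c k • E.Z i else 0 := by
    intro i k
    rw [hc, lie_add, lie_smul, hX, lie_eq_zero_of_mem_lowerCentralSeries_two h3 _ (hz k), add_zero]
    by_cases hik : i = k <;> simp [hik, eq_comm]
  choose r hr using hother
  have hrr : ∀ i k, i ≠ k → r k = i := fun i k hik => by
    have := hr k
    omega
  choose d hd using fun k => hoff (r k) k (hr k)
  have hW : ∀ i, ⁅X i, U i⁆ ∈ derivedCentralizer F M := fun i =>
    (mem_derivedCore_of_mem_lowerCentralSeries_one h3 (lie_mem_lowerCentralSeries_one _ _)).1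
  -- subtracting this multiple of `⁅X i, U i⁆ ∈ γ₂`, `i ≠ k`, from `U k` kills `⁅X i, U k⁆`; the
  -- other brackets do not change, because `U k` and `X k` commute with `⁅X i, U i⁆`
  refine ⟨fun k => U k - (d k / c (r k)) • ⁅X (r k), U (r k)⁆, c, fun k =>
    Submodule.sub_mem _ (hUC k) (Submodule.smul_mem _ _ (hW _)), fun i k => ?_, fun i k hik => ?_,
    hc0, fun i => ?_⟩
  · have h1 : ∀ i k, ⁅U i, ⁅X k, U k⁆⁆ = 0 := fun i k =>
      hUC i _ (lie_mem_lowerCentralSeries_one _ _)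
    have h2 : ∀ i k, ⁅⁅X k, U k⁆, U i⁆ = 0 := fun i k => by rw [← lie_skew, h1, neg_zero]
    have h4 : ∀ i k, ⁅⁅X i, U i⁆, ⁅X k, U k⁆⁆ = 0 := fun i k =>
      hW i _ (lie_mem_lowerCentralSeries_one _ _)
    simp only [lie_sub, sub_lie, lie_smul, smul_lie, hUU, h1, h2, h4, smul_zero, sub_zero]
  · have h1 := hd k
    rw [hrr i k hik] at h1
    rw [lie_sub, lie_smul, hXW, hrr i k hik, h1, if_pos rfl, smul_smul, div_mul_cancel₀ _ (hc0 i),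
      sub_self]
  · rw [lie_sub, lie_smul, hXW, if_neg (hr i), smul_zero, sub_zero, hc, add_sub_cancel_left]
    exact hz i

end TwoTwo

end EigenFrame

/-! ### The grading over the algebraic closure -/

namespace EigenFrame

variable {F M : Type*} [Field F] [LieRing M] [LieAlgebra F M] {f : End F M}

section Complement

variable (E : EigenFrame f 2)

include E

theorem coord_eq_zero_of_sum_lie_mem {X U : Fin 2 → M} {a b : Fin 2 → F} (ha : ∀ i, a i ≠ 0)
    (hXU : ∀ i, ⁅X i, U i⁆ - a i • E.Y i ∈ lowerCentralSeries F M M 2)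
    (hb : ∑ i, b i • ⁅X i, U i⁆ ∈ lowerCentralSeries F M M 2) : b = 0 := by
  have h1 : ∑ i, (b i * a i) • E.Y i ∈ lowerCentralSeries F M M 2 := by
    have h2 := sub_mem hb
      (sum_mem (t := Finset.univ) fun i _ => SMulMemClass.smul_mem (b i) (hXU i))
    simpa only [smul_sub, smul_smul, Finset.sum_sub_distrib, sub_sub_cancel] using h2
  funext i
  exact (mul_eq_zero.1 (congrFun (E.Y_indep _ h1) i)).resolve_right (ha i)

/-- The span of the `X i` and `U i` is a four dimensional complement of the derived core. -/
theorem isCompl_derivedCore (h3 : lowerCentralSeries F M M 3 = ⊥) {X U : Fin 2 → M}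
    (hX : ∀ i j, ⁅X i, E.Y j⁆ = if i = j then E.Z i else 0) (hXX : ∀ i k, ⁅X i, X k⁆ = 0)
    (hdec : ∀ x, ∃ c : Fin 2 → F, x - ∑ i, c i • X i ∈ derivedCentralizer F M)
    {a : Fin 2 → F} (hU : ∀ i, U i ∈ derivedCentralizer F M)
    (hoff : ∀ i k, i ≠ k → ⁅X i, U k⁆ = 0) (ha : ∀ i, a i ≠ 0)
    (hXU : ∀ i, ⁅X i, U i⁆ - a i • E.Y i ∈ lowerCentralSeries F M M 2) :
    LinearIndependent F (Sum.elim X U) ∧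
      IsCompl (Submodule.span F (Set.range (Sum.elim X U))) (derivedCore F M) := by
  have hXsum : ∀ (b : Fin 2 → F) i, ⁅X i, ∑ k, b k • U k⁆ = b i • ⁅X i, U i⁆ := fun b i => by
    rw [lie_sum, Finset.sum_eq_single i
      (fun k _ hk => by rw [lie_smul, hoff i k hk.symm, smul_zero]) (by simp), lie_smul]
  have key : ∀ c : Fin 2 ⊕ Fin 2 → F, ∑ i, c i • Sum.elim X U i ∈ derivedCore F M → c = 0 := by
    intro c hc
    rw [Fintype.sum_sum_type] at hc
    simp only [Sum.elim_inl, Sum.elim_inr] at hc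
    have h1 : ∀ j, c (Sum.inl j) = 0 := by
      intro j
      have h2 := hc.1 _ (E.Y_mem j)
      have h4 : ∀ i, ⁅U i, E.Y j⁆ = 0 := fun i => hU i _ (E.Y_mem j)
      simp only [add_lie, sum_lie, smul_lie, hX, h4, smul_zero, Finset.sum_const_zero, add_zero,
        smul_ite, Finset.sum_ite_eq', Finset.mem_univ, if_true] at h2
      exact (smul_eq_zero.1 h2).resolve_right (E.Z_ne_zero j)
    simp only [h1, zero_smul, Finset.sum_const_zero, zero_add] at hc
    have h2 : (fun i => c (Sum.inr i)) = 0 := by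
      refine E.coord_eq_zero_of_sum_lie_mem ha hXU (sum_mem fun i _ => ?_)
      rw [← hXsum (fun i => c (Sum.inr i)) i]
      exact hc.2 (X i)
    funext i
    rcases i with i | i
    · exact h1 i
    · exact congrFun h2 i
  refine ⟨Fintype.linearIndependent_iff.2 fun c hc i =>
    congrFun (key c (by rw [hc]; exact zero_mem _)) i, ?_, ?_⟩
  · rw [Submodule.disjoint_def]
    intro x hx hxD
    obtain ⟨c, rfl⟩ := (Submodule.mem_span_range_iff_exists_fun F).1 hx
    simp [key c hxD]
  · rw [codisjoint_iff, eq_top_iff]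
    rintro x -
    obtain ⟨c, hc⟩ := hdec x
    set u := x - ∑ i, c i • X i with hu
    choose d z hz hd using fun i => E.exists_lie_X_eq h3 hX hXX u i
    have hmem : u - ∑ i, (d i / a i) • U i ∈ derivedCore F M := by
      have h1 : u - ∑ i, (d i / a i) • U i ∈ derivedCentralizer F M :=
        Submodule.sub_mem _ hc (Submodule.sum_mem _ fun i _ => Submodule.smul_mem _ _ (hU i))
      refine ⟨h1, fun y => ?_⟩
      obtain ⟨e, he⟩ := hdec y
      have hy : y = ∑ i, e i • X i + (y - ∑ i, e i • X i) := by abel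
      rw [hy, add_lie]
      refine add_mem ?_ (E.lie_mem_of_mem_derivedCentralizer h3 hX he h1)
      rw [sum_lie]
      refine sum_mem fun i _ => ?_
      rw [smul_lie]
      refine SMulMemClass.smul_mem _ ?_
      rw [lie_sub, hXsum (fun i => d i / a i), hd]
      have h2 := sub_mem (hz i) (SMulMemClass.smul_mem (d i / a i) (hXU i))
      rw [smul_sub, smul_smul, div_mul_cancel₀ _ (ha i)] at h2
      refine (congrArg (· ∈ lowerCentralSeries F M M 2) ?_).mp h2
      abel
    rw [Submodule.mem_sup]
    refine ⟨∑ i, c i • X i + ∑ i, (d i / a i) • U i, ?_, _, hmem, ?_⟩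
    · refine add_mem (sum_mem fun i _ => Submodule.smul_mem _ _ ?_)
        (sum_mem fun i _ => Submodule.smul_mem _ _ ?_)
      · exact Submodule.subset_span ⟨Sum.inl i, rfl⟩
      · exact Submodule.subset_span ⟨Sum.inr i, rfl⟩
    · rw [hu]; abel

/-- If the derived core is abelian, then `span (X, U) ⊕ W₂ ⊕ γ₃` is a grading for a suitable
complement `W₂` of `γ₃` in the derived core; it is recorded through the derivation with the
eigenvalues `1`, `2`, `3` on the three summands. -/
theorem exists_derivation (h3 : lowerCentralSeries F M M 3 = ⊥) {X U : Fin 2 → M}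
    (hX : ∀ i j, ⁅X i, E.Y j⁆ = if i = j then E.Z i else 0) (hXX : ∀ i k, ⁅X i, X k⁆ = 0)
    (hdec : ∀ x, ∃ c : Fin 2 → F, x - ∑ i, c i • X i ∈ derivedCentralizer F M)
    {a : Fin 2 → F} (hU : ∀ i, U i ∈ derivedCentralizer F M) (hUU : ∀ i k, ⁅U i, U k⁆ = 0)
    (hoff : ∀ i k, i ≠ k → ⁅X i, U k⁆ = 0) (ha : ∀ i, a i ≠ 0)
    (hXU : ∀ i, ⁅X i, U i⁆ - a i • E.Y i ∈ lowerCentralSeries F M M 2)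
    (hDD : ∀ u ∈ derivedCore F M, ∀ v ∈ derivedCore F M, ⁅u, v⁆ = 0) :
    ∃ δ : End F M, (∀ x y, δ ⁅x, y⁆ = ⁅δ x, y⁆ + ⁅x, δ y⁆) ∧
      (∀ x, δ x - x ∈ derivedCore F M) ∧
      (∀ u ∈ derivedCore F M, δ u - (2 : F) • u ∈ lowerCentralSeries F M M 2) ∧
      ∀ z ∈ lowerCentralSeries F M M 2, δ z = (3 : F) • z := by
  obtain ⟨-, hE⟩ := E.isCompl_derivedCore h3 hX hXX hdec hU hoff ha hXU
  set P := Submodule.span F (Set.range (Sum.elim X U))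
  set D := derivedCore F M
  set G := (lowerCentralSeries F M M 2).toSubmodule
  set W := fun i => ⁅X i, U i⁆
  have h1D : ∀ y ∈ lowerCentralSeries F M M 1, y ∈ D := fun y hy =>
    mem_derivedCore_of_mem_lowerCentralSeries_one h3 hy
  have hGD : G ≤ D := fun z hz => h1D z (lowerCentralSeries_two_le_one hz)
  have hWD : ∀ i, W i ∈ D := fun i => h1D _ (lie_mem_lowerCentralSeries_one _ _)
  have hdisj : Disjoint (P ⊔ Submodule.span F (Set.range W)) G := by
    rw [Submodule.disjoint_def]
    intro x hx hxG
    obtain ⟨p, hp, w, hw, rfl⟩ := Submodule.mem_sup.1 hx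
    obtain ⟨b, rfl⟩ := (Submodule.mem_span_range_iff_exists_fun F).1 hw
    have hwD : ∑ i, b i • W i ∈ D := sum_mem fun i _ => Submodule.smul_mem _ _ (hWD i)
    have hp0 : p = 0 := by
      refine Submodule.disjoint_def.1 hE.disjoint p hp ?_
      simpa using D.sub_mem (hGD hxG) hwD
    rw [hp0, zero_add] at hxG ⊢
    simp [E.coord_eq_zero_of_sum_lie_mem ha hXU hxG]
  obtain ⟨Q, hQ, hQG⟩ := hdisj.exists_isCompl
  have hPQ : P ≤ Q := le_sup_left.trans hQ
  have hWQ : ∀ i, W i ∈ Q := fun i =>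
    hQ (Submodule.mem_sup_right (Submodule.subset_span ⟨i, rfl⟩))
  -- the weights are `1` on `P`, `2` on `Q ∩ D` and `3` on `G`
  set π₁ := P.projection D hE
  set π₃ := G.projection Q hQG.symm
  set δ : End F M := (2 : F) • LinearMap.id - π₁ + π₃ with hδ
  have hδx : ∀ x, δ x = (2 : F) • x - π₁ x + π₃ x := fun x => rfl
  have hπ₁D : ∀ x ∈ D, π₁ x = 0 := fun x hx =>
    (Submodule.projection_apply_eq_zero_iff hE).2 hx
  have hπ₁P : ∀ x ∈ P, π₁ x = x := fun x hx => Submodule.projection_apply_of_mem_left hE hx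
  have hπ₃Q : ∀ x ∈ Q, π₃ x = 0 := fun x hx =>
    (Submodule.projection_apply_eq_zero_iff hQG.symm).2 hx
  have hπ₃G : ∀ x ∈ G, π₃ x = x := fun x hx =>
    Submodule.projection_apply_of_mem_left hQG.symm hx
  have hπ₃ : ∀ x, π₃ x ∈ G := Submodule.projection_apply_mem hQG.symm
  have hδP : ∀ x ∈ P, δ x = x := fun x hx => by
    rw [hδx, hπ₁P x hx, hπ₃Q x (hPQ hx)]; module
  have hδQ : ∀ x ∈ Q, x ∈ D → δ x = (2 : F) • x := fun x hx hxD => by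
    rw [hδx, hπ₁D x hxD, hπ₃Q x hx]; module
  have hδG : ∀ x ∈ G, δ x = (3 : F) • x := fun x hx => by
    rw [hδx, hπ₁D x (hGD hx), hπ₃G x hx]; module
  have hsplit : ∀ x, ∃ p ∈ P, ∃ q ∈ Q, q ∈ D ∧ ∃ z ∈ G, x = p + q + z := by
    intro x
    obtain ⟨p, hp, d, hd, rfl⟩ := Submodule.mem_sup.1
      (hE.sup_eq_top ▸ Submodule.mem_top : x ∈ P ⊔ D)
    obtain ⟨q, hq, z, hz, rfl⟩ := Submodule.mem_sup.1
      (hQG.sup_eq_top ▸ Submodule.mem_top : d ∈ Q ⊔ G)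
    exact ⟨p, hp, q, hq, by simpa using D.sub_mem hd (hGD hz), z, hz, by abel⟩
  have hPP : ∀ p ∈ P, ∀ p' ∈ P, ⁅p, p'⁆ ∈ Q ∧ ⁅p, p'⁆ ∈ D := by
    intro p hp p' hp'
    refine ⟨?_, h1D _ (lie_mem_lowerCentralSeries_one _ _)⟩
    have hXUQ : ∀ i k, ⁅X i, U k⁆ ∈ Q := fun i k => by
      by_cases hik : i = k
      · exact hik ▸ hWQ i
      · rw [hoff i k hik]; exact Q.zero_mem
    have hUXQ : ∀ i k, ⁅U k, X i⁆ ∈ Q := fun i k => by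
      rw [← lie_skew]; exact Q.neg_mem (hXUQ i k)
    obtain ⟨c, rfl⟩ := (Submodule.mem_span_range_iff_exists_fun F).1 hp
    obtain ⟨d, rfl⟩ := (Submodule.mem_span_range_iff_exists_fun F).1 hp'
    simp only [sum_lie, lie_sum, smul_lie, lie_smul]
    refine Q.sum_mem fun i _ => Q.smul_mem _ (Q.sum_mem fun k _ => Q.smul_mem _ ?_)
    rcases i with i | i <;> rcases k with k | k <;>
      simp [hXX, hUU, hXUQ, hUXQ]
  refine ⟨δ, fun x y => ?_, fun x => ?_, fun u hu => ?_, hδG⟩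
  · obtain ⟨p, hp, q, hq, hqD, z, hz, rfl⟩ := hsplit x
    obtain ⟨p', hp', q', hq', hqD', z', hz', rfl⟩ := hsplit y
    have hz0 : ∀ x, ⁅x, z⁆ = 0 := fun x => lie_eq_zero_of_mem_lowerCentralSeries_two h3 x hz
    have hz0' : ∀ x, ⁅x, z'⁆ = 0 := fun x => lie_eq_zero_of_mem_lowerCentralSeries_two h3 x hz'
    have hz1 : ∀ x : M, ⁅z, x⁆ = 0 := fun x => by rw [← lie_skew, hz0, neg_zero]
    have h1 : δ ⁅p, p'⁆ = (2 : F) • ⁅p, p'⁆ := hδQ _ (hPP p hp p' hp').1 (hPP p hp p' hp').2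
    have h2 : δ ⁅p, q'⁆ = (3 : F) • ⁅p, q'⁆ := hδG _ (hqD'.2 p)
    have h4 : δ ⁅q, p'⁆ = (3 : F) • ⁅q, p'⁆ := hδG _ (by
      rw [← lie_skew]; exact G.neg_mem (hqD.2 p'))
    simp only [map_add, hδP p hp, hδP p' hp', hδQ q hq hqD, hδQ q' hq' hqD', hδG z hz,
      hδG z' hz', add_lie, lie_add, smul_lie, lie_smul, hz0', hz1, hDD q hqD q' hqD',
      h1, h2, h4, map_zero]
    module
  · have h1 : δ x - x = (x - π₁ x) + π₃ x := by rw [hδx]; module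
    rw [h1]
    refine D.add_mem ?_ (hGD (hπ₃ x))
    obtain ⟨p, hp, q, hq, hqD, z, hz, rfl⟩ := hsplit x
    have h2 : p + q + z - π₁ (p + q + z) = q + z := by
      rw [map_add, map_add, hπ₁P p hp, hπ₁D q hqD, hπ₁D z (hGD hz)]; abel
    rw [h2]
    exact D.add_mem hqD (hGD hz)
  · have h1 : δ u - (2 : F) • u = π₃ u := by rw [hδx, hπ₁D u hu]; module
    rw [h1]
    exact hπ₃ u

end Complement

end EigenFrame

/-! ### Extension of scalars and descent of derivations -/

section Descent

open scoped TensorProduct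

variable {K F V V' L : Type*} [Field K] [Field F] [Algebra K F] [AddCommGroup V] [Module K V]
  [AddCommGroup V'] [Module K V'] [LieRing L] [LieAlgebra K L]

/-- The contraction `F ⊗ V → V` along a linear functional `F → K`. -/
noncomputable def contract (r : F →ₗ[K] K) : F ⊗[K] V →ₗ[K] V :=
  (TensorProduct.lid K V).toLinearMap ∘ₗ r.rTensor V

@[simp]
theorem contract_tmul (r : F →ₗ[K] K) (c : F) (x : V) : contract r (c ⊗ₜ[K] x) = r c • x := by
  simp [contract]

theorem contract_smul (r : F →ₗ[K] K) (a : F) (m : F ⊗[K] V) :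
    contract r (a • m) = contract (r ∘ₗ LinearMap.mulLeft K a) m := by
  induction m using TensorProduct.induction_on with
  | zero => simp
  | tmul c x => simp [TensorProduct.smul_tmul']
  | add a b ha hb => rw [smul_add, map_add, ha, hb, map_add]

theorem contract_baseChange (r : F →ₗ[K] K) (h : V →ₗ[K] V') (m : F ⊗[K] V) :
    contract r (h.baseChange F m) = h (contract r m) := by
  induction m using TensorProduct.induction_on with
  | zero => simp
  | tmul c x => simp
  | add a b ha hb => rw [map_add, map_add, ha, hb, map_add, map_add]

theorem mem_baseChange_iff_contract {N : Submodule K V} {m : F ⊗[K] V} :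
    m ∈ N.baseChange F ↔ ∀ r : F →ₗ[K] K, contract r m ∈ N := by
  constructor
  · intro hm
    rw [Submodule.baseChange_eq_span] at hm
    induction hm using Submodule.span_induction with
    | mem x hx =>
      obtain ⟨n, hn, rfl⟩ := hx
      intro r
      simpa using N.smul_mem _ hn
    | zero => simp
    | add x y _ _ hx hy => intro r; rw [map_add]; exact N.add_mem (hx r) (hy r)
    | smul a x _ hx => intro r; rw [contract_smul]; exact hx _
  · intro h
    set b := Basis.ofVectorSpace K F
    obtain ⟨c, rfl⟩ := TensorProduct.eq_repr_basis_left b m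
    have hc : ∀ i, c i ∈ N := by
      intro i
      have h1 := h (b.coord i)
      rw [Finsupp.sum, map_sum] at h1
      simp only [contract_tmul, Basis.coord_apply, Basis.repr_self] at h1
      rwa [Finset.sum_eq_single i (fun j _ hj => by rw [Finsupp.single_eq_of_ne' hj, zero_smul])
        (fun hi => by rw [Finsupp.notMem_support_iff.1 hi, smul_zero]), Finsupp.single_eq_same,
        one_smul] at h1
    exact Submodule.sum_mem _ fun i _ => Submodule.tmul_mem_baseChange_of_mem _ (hc i)

theorem eq_zero_iff_contract {m : F ⊗[K] V} : m = 0 ↔ ∀ r : F →ₗ[K] K, contract r m = 0 := by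
  rw [← Submodule.mem_bot F, ← Submodule.baseChange_bot (R := K), mem_baseChange_iff_contract]
  simp only [Submodule.mem_bot]

theorem contract_lie_one_tmul (r : F →ₗ[K] K) (m : F ⊗[K] L) (y : L) :
    contract r ⁅m, (1 : F) ⊗ₜ[K] y⁆ = ⁅contract r m, y⁆ := by
  induction m using TensorProduct.induction_on with
  | zero => simp
  | tmul c x => simp
  | add a b ha hb => rw [add_lie, map_add, ha, hb, map_add, add_lie]

theorem contract_one_tmul_lie (r : F →ₗ[K] K) (m : F ⊗[K] L) (y : L) :
    contract r ⁅(1 : F) ⊗ₜ[K] y, m⁆ = ⁅y, contract r m⁆ := by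
  rw [← lie_skew, map_neg, contract_lie_one_tmul, lie_skew]

theorem mem_lowerCentralSeries_tensor_iff {k : ℕ} {m : F ⊗[K] L} :
    m ∈ lowerCentralSeries F (F ⊗[K] L) (F ⊗[K] L) k ↔
      ∀ r : F →ₗ[K] K, contract r m ∈ lowerCentralSeries K L L k := by
  rw [LieSubmodule.lowerCentralSeries_tensor_eq_baseChange]
  exact mem_baseChange_iff_contract

theorem one_tmul_mem_lowerCentralSeries_tensor {k : ℕ} {x : L}
    (hx : x ∈ lowerCentralSeries K L L k) :
    (1 : F) ⊗ₜ[K] x ∈ lowerCentralSeries F (F ⊗[K] L) (F ⊗[K] L) k := by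
  rw [LieSubmodule.lowerCentralSeries_tensor_eq_baseChange]
  exact LieSubmodule.tmul_mem_baseChange_of_mem _ hx

theorem derivedCore_tensor :
    derivedCore F (F ⊗[K] L) = (derivedCore K L).baseChange F := by
  apply le_antisymm
  · intro m hm
    rw [mem_baseChange_iff_contract]
    refine fun r => ⟨fun y hy => ?_, fun x => ?_⟩
    · rw [← contract_lie_one_tmul, hm.1 _ (one_tmul_mem_lowerCentralSeries_tensor hy), map_zero]
    · rw [← contract_one_tmul_lie]
      exact mem_lowerCentralSeries_tensor_iff.1 (hm.2 _) r
  · rw [Submodule.baseChange_eq_span, Submodule.span_le]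
    rintro _ ⟨u, hu, rfl⟩
    refine ⟨fun y hy => ?_, fun x => ?_⟩
    · rw [LieSubmodule.lowerCentralSeries_tensor_eq_baseChange, LieSubmodule.mem_baseChange_iff]
        at hy
      induction hy using Submodule.span_induction with
      | mem y hy =>
        obtain ⟨y, hy, rfl⟩ := hy
        simp [hu.1 y hy]
      | zero => simp
      | add a b _ _ ha hb => rw [lie_add, ha, hb, add_zero]
      | smul a b _ hb => rw [lie_smul, hb, smul_zero]
    · induction x using TensorProduct.induction_on with
      | zero => simp
      | tmul c x =>
        rw [LieSubmodule.lowerCentralSeries_tensor_eq_baseChange]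
        simpa using LieSubmodule.tmul_mem_baseChange_of_mem (A := F) c (hu.2 x)
      | add a b ha hb => rw [add_lie]; exact add_mem ha hb

theorem lie_eq_zero_of_mem_derivedCore_tensor
    (h : ∀ u ∈ derivedCore K L, ∀ v ∈ derivedCore K L, ⁅u, v⁆ = 0) :
    ∀ u ∈ derivedCore F (F ⊗[K] L), ∀ v ∈ derivedCore F (F ⊗[K] L), ⁅u, v⁆ = 0 := by
  intro u hu v hv
  rw [derivedCore_tensor, Submodule.baseChange_eq_span] at hu hv
  refine Submodule.span_induction₂ (p := fun x y _ _ => ⁅x, y⁆ = 0) ?_ ?_ ?_ ?_ ?_ ?_ ?_ hu hv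
  · rintro _ _ ⟨x, hx, rfl⟩ ⟨y, hy, rfl⟩
    simp [h x hx y hy]
  · simp
  · simp
  · intro x y z _ _ _ h1 h2
    rw [add_lie, h1, h2, add_zero]
  · intro x y z _ _ _ h1 h2
    rw [lie_add, h1, h2, add_zero]
  · intro a x y _ _ h1
    rw [smul_lie, h1, smul_zero]
  · intro a x y _ _ h1
    rw [lie_smul, h1, smul_zero]

/-- The conditions on a derivation to induce `1`, `2` and `3` on the successive quotients of
`L ⊇ derivedCore ⊇ γ₃` form a system of affine linear equations over the base field, so a solution
over an extension field yields one over the base field. -/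
theorem exists_derivation_descent
    (h : ∃ δ : End F (F ⊗[K] L), (∀ x y, δ ⁅x, y⁆ = ⁅δ x, y⁆ + ⁅x, δ y⁆) ∧
      (∀ x, δ x - x ∈ derivedCore F (F ⊗[K] L)) ∧
      (∀ u ∈ derivedCore F (F ⊗[K] L),
        δ u - (2 : F) • u ∈ lowerCentralSeries F (F ⊗[K] L) (F ⊗[K] L) 2) ∧
      ∀ z ∈ lowerCentralSeries F (F ⊗[K] L) (F ⊗[K] L) 2, δ z = (3 : F) • z) :
    ∃ δ : End K L, (∀ x y, δ ⁅x, y⁆ = ⁅δ x, y⁆ + ⁅x, δ y⁆) ∧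
      (∀ x, δ x - x ∈ derivedCore K L) ∧
      (∀ u ∈ derivedCore K L, δ u - (2 : K) • u ∈ lowerCentralSeries K L L 2) ∧
      ∀ z ∈ lowerCentralSeries K L L 2, δ z = (3 : K) • z := by
  obtain ⟨δ, hδ, h1, h2, h3⟩ := h
  obtain ⟨r, hr⟩ := (Algebra.linearMap K F).exists_leftInverse_of_injective
    (LinearMap.ker_eq_bot.2 (algebraMap K F).injective)
  have hr1 : r 1 = 1 := by simpa using LinearMap.congr_fun hr 1
  have hc : ∀ x : L, contract r ((1 : F) ⊗ₜ[K] x) = x := fun x => by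
    rw [contract_tmul, hr1, one_smul]
  have hsmul : ∀ (n : K) (x : L),
      contract r ((algebraMap K F n) • ((1 : F) ⊗ₜ[K] x)) = n • x := fun n x => by
    rw [algebraMap_smul, map_smul, hc]
  have h2' : (algebraMap K F 2) = 2 := map_ofNat _ 2
  have h3' : (algebraMap K F 3) = 3 := map_ofNat _ 3
  refine ⟨contract r ∘ₗ δ.restrictScalars K ∘ₗ TensorProduct.mk K F L 1, fun x y => ?_,
    fun x => ?_, fun u hu => ?_, fun z hz => ?_⟩
  · have h4 : (1 : F) ⊗ₜ[K] ⁅x, y⁆ = ⁅(1 : F) ⊗ₜ[K] x, (1 : F) ⊗ₜ[K] y⁆ := by simp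
    simp only [LinearMap.comp_apply, TensorProduct.mk_apply, LinearMap.restrictScalars_apply]
    rw [h4, hδ, map_add, contract_lie_one_tmul, contract_one_tmul_lie]
  · have h4 := h1 ((1 : F) ⊗ₜ[K] x)
    rw [derivedCore_tensor, mem_baseChange_iff_contract] at h4
    simpa [hc] using h4 r
  · have h4 := h2 ((1 : F) ⊗ₜ[K] u) (by
      rw [derivedCore_tensor]; exact Submodule.tmul_mem_baseChange_of_mem _ hu)
    have h5 := mem_lowerCentralSeries_tensor_iff.1 h4 r
    rw [map_sub, ← h2', hsmul] at h5
    exact h5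
  · have h4 := h3 _ (one_tmul_mem_lowerCentralSeries_tensor hz)
    simp only [LinearMap.comp_apply, TensorProduct.mk_apply, LinearMap.restrictScalars_apply]
    rw [h4, ← h3', hsmul]

end Descent

/-! ### Gradings from derivations -/

section Grading

variable {K L : Type*} [Field K] [CharZero K] [LieRing L] [LieAlgebra K L]

/-- The eigenspaces of a derivation annihilated by `(t - 1) (t - 2) (t - 3)` are a grading. -/
theorem hasPositiveGrading_of_derivation {δ : End K L}
    (hδ : ∀ x y, δ ⁅x, y⁆ = ⁅δ x, y⁆ + ⁅x, δ y⁆)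
    (h1 : ∀ x, δ x - x ∈ derivedCore K L)
    (h2 : ∀ u ∈ derivedCore K L, δ u - (2 : K) • u ∈ lowerCentralSeries K L L 2)
    (h3 : ∀ z ∈ lowerCentralSeries K L L 2, δ z = (3 : K) • z) : HasPositiveGrading K L := by
  refine ⟨fun i => δ.eigenspace ((i : ℕ) : K), ?_, fun i j x hx y hy => ?_⟩
  · refine DirectSum.isInternal_submodule_of_iSupIndep_of_iSup_eq_top ?_ ?_
    · exact δ.eigenspaces_iSupIndep.comp
        (f := fun i : ℕ+ => ((i : ℕ) : K)) (Nat.cast_injective.comp PNat.coe_injective)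
    · rw [eq_top_iff]
      rintro x -
      have hz := h3 _ (h2 _ (h1 x))
      simp only [map_sub, map_smul] at hz
      -- Lagrange interpolation at the points `1`, `2`, `3`
      have hx : x = (2⁻¹ : K) • (δ (δ x) - (5 : K) • δ x + (6 : K) • x)
          + (-(δ (δ x) - (4 : K) • δ x + (3 : K) • x)
          + (2⁻¹ : K) • (δ (δ x) - (3 : K) • δ x + (2 : K) • x)) := by
        module
      have hzz : δ (δ (δ x)) = (6 : K) • δ (δ x) - (11 : K) • δ x + (6 : K) • x := by
        rw [← sub_eq_zero] at hz ⊢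
        rw [← hz]
        module
      rw [hx]
      refine add_mem ?_ (add_mem ?_ ?_)
      · refine Submodule.mem_iSup_of_mem (1 : ℕ+) ?_
        rw [End.mem_eigenspace_iff]
        simp only [map_smul, map_add, map_sub, hzz, PNat.one_coe, Nat.cast_one]
        module
      · refine Submodule.mem_iSup_of_mem (2 : ℕ+) ?_
        rw [End.mem_eigenspace_iff]
        simp only [map_smul, map_add, map_sub, map_neg, hzz, PNat.val_ofNat, Nat.cast_ofNat]
        module
      · refine Submodule.mem_iSup_of_mem (3 : ℕ+) ?_
        rw [End.mem_eigenspace_iff]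
        simp only [map_smul, map_add, map_sub, hzz, PNat.val_ofNat, Nat.cast_ofNat]
        module
  · rw [End.mem_eigenspace_iff] at hx hy ⊢
    rw [hδ, hx, hy, smul_lie, lie_smul, PNat.add_coe, Nat.cast_add, add_smul]

end Grading

/-! ### Eigenvectors of subquotients -/

section EigenbasisQuotient

open scoped TensorProduct

variable {K F L : Type*} [Field K] [Field F] [Algebra K F]

/-- Over an algebraically closed field, an endomorphism whose characteristic polynomial is
irreducible and separable over the base field has a basis of eigenvectors with distinct
eigenvalues. -/
theorem exists_eigenbasis_baseChange {V : Type*} [AddCommGroup V] [Module K V]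
    [FiniteDimensional K V] [PerfectField K] [IsAlgClosed F] (g : End K V)
    (hg : Irreducible g.charpoly) {n : ℕ} (hn : finrank K V = n) :
    ∃ μ : Fin n → F, Function.Injective μ ∧
      (∀ a, Polynomial.aeval a g.charpoly = 0 ↔ ∃ j, μ j = a) ∧
      ∏ j, μ j = algebraMap K F (LinearMap.det g) ∧
      ∃ b : Basis (Fin n) F (F ⊗[K] V), ∀ j, g.baseChange F (b j) = μ j • b j := by
  have hcard : Fintype.card (g.charpoly.rootSet F) = n := by
    rw [Polynomial.card_rootSet_eq_natDegree (PerfectField.separable_of_irreducible hg)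
      (IsAlgClosed.splits _), LinearMap.charpoly_natDegree, hn]
  let e := Fintype.equivFinOfCardEq hcard
  set μ : Fin n → F := fun j => (e.symm j : F) with hμ
  have hinj : Function.Injective μ := Subtype.val_injective.comp e.symm.injective
  have hroot : ∀ a, Polynomial.aeval a g.charpoly = 0 ↔ ∃ j, μ j = a := by
    intro a
    constructor
    · intro ha
      have : a ∈ g.charpoly.rootSet F := by
        rw [Polynomial.mem_rootSet]; exact ⟨g.charpoly_monic.ne_zero, ha⟩
      exact ⟨e ⟨a, this⟩, by simp [hμ]⟩
    · rintro ⟨j, rfl⟩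
      exact (Polynomial.mem_rootSet.1 (e.symm j).2).2
  have hev : ∀ j, End.HasEigenvalue (g.baseChange F) (μ j) := by
    intro j
    rw [End.hasEigenvalue_iff_isRoot_charpoly, LinearMap.charpoly_baseChange, Polynomial.IsRoot.def,
      Polynomial.eval_map_algebraMap]
    exact (hroot _).2 ⟨j, rfl⟩
  choose v hv using fun j => (hev j).exists_hasEigenvector
  have hli : LinearIndependent F v := End.eigenvectors_linearIndependent' _ μ hinj v hv
  have hfin : Fintype.card (Fin n) = finrank F (F ⊗[K] V) := by
    rw [Module.finrank_baseChange, hn, Fintype.card_fin]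
  have : Nonempty (Fin n) := by
    rw [← Fin.pos_iff_nonempty, ← hn, ← g.charpoly_natDegree]
    exact hg.natDegree_pos
  set b := basisOfLinearIndependentOfCardEqFinrank hli hfin with hb
  have hbv : ∀ j, g.baseChange F (b j) = μ j • b j := fun j => by
    rw [hb, coe_basisOfLinearIndependentOfCardEqFinrank]
    exact (hv j).apply_eq_smul
  refine ⟨μ, hinj, hroot, ?_, b, hbv⟩
  rw [← LinearMap.det_baseChange, ← LinearMap.det_toMatrix b]
  have : LinearMap.toMatrix b b (g.baseChange F) = Matrix.diagonal μ := by
    ext i j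
    rw [LinearMap.toMatrix_apply, hbv, map_smul, Basis.repr_self, Matrix.diagonal_apply]
    by_cases hij : i = j
    · simp [hij]
    · simp [hij, Finsupp.single_eq_of_ne hij]
  rw [this, Matrix.det_diagonal]

variable [AddCommGroup L] [Module K L] [FiniteDimensional K L]

/-- A subquotient `N / N'` of dimension at most three on which there can be no eigenvalue in the
base field has irreducible characteristic polynomial, and an eigenbasis over the algebraic closure;
its members are lifted to generalized eigenvectors in `F ⊗ N`. -/
theorem exists_eigenvectors_quotient [CharZero K] [IsAlgClosed F]
    {N N' : Submodule K L}
    {φ : End K L} (hN : ∀ x ∈ N, φ x ∈ N) (hN' : ∀ x ∈ N', φ x ∈ N')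
    (hφ : ∀ c, ¬ φ.HasEigenvalue c) {n : ℕ} (hn1 : 1 ≤ n) (hn3 : n ≤ 3)
    (hfin : finrank K (N ⧸ N'.submoduleOf N) = n) :
    ∃ p : Polynomial K, Irreducible p ∧ p.Monic ∧ p.natDegree = n ∧
      ∃ μ : Fin n → F, Function.Injective μ ∧ (∀ a, Polynomial.aeval a p = 0 ↔ ∃ j, μ j = a) ∧
      (∃ d : K, ∏ j, μ j = algebraMap K F d) ∧
      ∃ Y : Fin n → F ⊗[K] L, (∀ j, Y j ∈ N.baseChange F) ∧
        (∀ j, φ.baseChange F (Y j) - μ j • Y j ∈ N'.baseChange F) ∧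
        (∀ j, Y j ∈ End.maxGenEigenspace (φ.baseChange F) (μ j)) ∧
        (∀ y ∈ N.baseChange F, ∃ c : Fin n → F, y - ∑ j, c j • Y j ∈ N'.baseChange F) ∧
        ∀ c : Fin n → F, ∑ j, c j • Y j ∈ N'.baseChange F → c = 0 := by
  set φN : End K N := φ.restrict hN
  have hle : N'.submoduleOf N ≤ (N'.submoduleOf N).comap φN := fun x hx => hN' _ hx
  set g : End K (N ⧸ N'.submoduleOf N) := (N'.submoduleOf N).mapQ _ φN hle
  set q := (N'.submoduleOf N).mkQ
  have hgq : ∀ x, g (q x) = q (φN x) := fun x => rfl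
  have hq0 : ∀ x : N, q x = 0 ↔ (x : L) ∈ N' := fun x => by
    rw [Submodule.mkQ_apply, Submodule.Quotient.mk_eq_zero]; rfl
  have hirr : Irreducible g.charpoly := by
    refine Polynomial.irreducible_of_degree_le_three_of_not_isRoot ?_ fun c hc => ?_
    · rw [LinearMap.charpoly_natDegree, hfin, Finset.mem_Icc]
      exact ⟨hn1, hn3⟩
    · rw [← End.hasEigenvalue_iff_isRoot_charpoly] at hc
      obtain ⟨v, hv⟩ := hc.exists_hasEigenvector
      obtain ⟨x, rfl⟩ := Submodule.mkQ_surjective _ v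
      have h1 : φ x - c • (x : L) ∈ N' := by
        have h2 := hv.apply_eq_smul
        change g (q x) = c • q x at h2
        rw [hgq, ← map_smul, ← sub_eq_zero, ← map_sub, hq0] at h2
        exact h2
      obtain ⟨y, hy, hyc, hyx⟩ := exists_maxGenEigenspace_lift hN hN' x.2 h1
      refine hφ c (hasEigenvalue_of_mem_maxGenEigenspace hyc fun h0 => hv.2 ?_)
      change q x = 0
      rw [hq0]
      rw [h0, zero_sub] at hyx
      simpa using N'.neg_mem hyx
  obtain ⟨μ, hμ, hroot, hdet, b, hb⟩ := exists_eigenbasis_baseChange (F := F) g hirr hfin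
  refine ⟨g.charpoly, hirr, g.charpoly_monic, by rw [LinearMap.charpoly_natDegree, hfin], μ, hμ,
    hroot, ⟨_, hdet⟩, ?_⟩
  set f := φ.baseChange F
  set ι : F ⊗[K] N →ₗ[F] F ⊗[K] L := N.subtype.baseChange F
  have hιq : ∀ x, ι x ∈ N'.baseChange F ↔ q.baseChange F x = 0 := fun x => by
    rw [mem_baseChange_iff_contract, eq_zero_iff_contract]
    refine forall_congr' fun r => ?_
    rw [contract_baseChange, contract_baseChange, hq0]
    rfl
  have hιf : ∀ x, f (ι x) = ι (φN.baseChange F x) := fun x => by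
    induction x using TensorProduct.induction_on with
    | zero => simp
    | tmul c x => simp [f, ι, φN]
    | add x y hx hy => simp only [map_add, hx, hy]
  have hqf : ∀ x, q.baseChange F (φN.baseChange F x) = g.baseChange F (q.baseChange F x) :=
    fun x => by
      induction x using TensorProduct.induction_on with
      | zero => simp
      | tmul c x => simp [hgq]
      | add x y hx hy => simp only [map_add, hx, hy]
  have hsurj : Function.Surjective (q.baseChange F) :=
    LinearMap.lTensor_surjective F (Submodule.mkQ_surjective _)
  choose y hy using fun j => hsurj (b j)
  have hfN : ∀ W : Submodule K L, (∀ x ∈ W, φ x ∈ W) → ∀ x ∈ W.baseChange F,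
      f x ∈ W.baseChange F := fun W hW x hx => by
    rw [mem_baseChange_iff_contract] at hx ⊢
    intro r
    rw [contract_baseChange]
    exact hW _ (hx r)
  have hιN : ∀ x, ι x ∈ N.baseChange F := fun x => ⟨x, rfl⟩
  have hy1 : ∀ j, f (ι (y j)) - μ j • ι (y j) ∈ N'.baseChange F := fun j => by
    rw [hιf, ← map_smul, ← map_sub, hιq, map_sub, hqf, hy, hb, map_smul, hy, sub_self]
  choose Y hYN hYμ hYy using fun j =>
    exists_maxGenEigenspace_lift (hfN N hN) (hfN N' hN') (hιN (y j)) (hy1 j)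
  have hsum : ∀ c : Fin n → F, ∑ j, c j • Y j - ι (∑ j, c j • y j) ∈ N'.baseChange F := fun c => by
    have h1 : ∑ j, c j • (Y j - ι (y j)) ∈ N'.baseChange F :=
      Submodule.sum_mem _ fun j _ => Submodule.smul_mem _ _ (hYy j)
    simpa only [smul_sub, Finset.sum_sub_distrib, map_sum, map_smul] using h1
  refine ⟨Y, hYN, fun j => ?_, hYμ, ?_, ?_⟩
  · have h1 := Submodule.add_mem _ (Submodule.sub_mem _ (hfN N' hN' _ (hYy j))
      (Submodule.smul_mem _ (μ j) (hYy j))) (hy1 j)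
    refine (congrArg (· ∈ N'.baseChange F) ?_).mp h1
    rw [map_sub]
    module
  · rintro _ ⟨x, rfl⟩
    refine ⟨fun j => b.repr (q.baseChange F x) j, ?_⟩
    set c : Fin n → F := fun j => b.repr (q.baseChange F x) j
    have h1 : ι x - ι (∑ j, c j • y j) ∈ N'.baseChange F := by
      rw [← map_sub, hιq, map_sub, map_sum]
      simp only [map_smul, hy, c]
      rw [b.sum_repr, sub_self]
    have h2 := Submodule.sub_mem _ h1 (hsum c)
    refine (congrArg (· ∈ N'.baseChange F) ?_).mp h2
    change ι x - ι _ - _ = ι x - _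
    abel
  · intro c hc
    have h1 := Submodule.sub_mem _ hc (hsum c)
    rw [sub_sub_cancel, hιq, map_sum] at h1
    simp only [map_smul, hy] at h1
    exact funext fun j => Fintype.linearIndependent_iff.1 b.linearIndependent c h1 j

end EigenbasisQuotient

/-! ### Eigenvalues of hyperbolic integer-like maps -/

section Arithmetic

variable {F : Type*} [Field F] [Algebra ℚ F]

theorem sq_eq_one_of_isIntegral {d : ℚ} (h1 : IsIntegral ℤ (algebraMap ℚ F d))
    (h2 : IsIntegral ℤ (algebraMap ℚ F d)⁻¹) (h0 : d ≠ 0) : d ^ 2 = 1 := by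
  rw [← map_inv₀] at h2
  have hinj : Function.Injective ((algebraMap ℚ F).toIntAlgHom) := (algebraMap ℚ F).injective
  obtain ⟨n, hn⟩ := IsIntegrallyClosed.isIntegral_iff.1
    ((isIntegral_algHom_iff (algebraMap ℚ F).toIntAlgHom hinj).1 h1)
  obtain ⟨m, hm⟩ := IsIntegrallyClosed.isIntegral_iff.1
    ((isIntegral_algHom_iff (algebraMap ℚ F).toIntAlgHom hinj).1 h2)
  have hnm : n * m = 1 := by
    have : ((n * m : ℤ) : ℚ) = 1 := by
      push_cast
      have hn' : (n : ℚ) = d := hn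
      have hm' : (m : ℚ) = d⁻¹ := hm
      rw [hn', hm', mul_inv_cancel₀ h0]
    exact_mod_cast this
  have hn' : (n : ℚ) = d := hn
  rcases Int.eq_one_or_neg_one_of_mul_eq_one hnm with h | h <;> rw [← hn', h] <;> norm_num

variable {V : Type*} [AddCommGroup V] [Module ℚ V] [Module.Finite ℚ V] {φ : End ℚ V}

/-- The eigenvalues of an integer-like map are units of the ring of algebraic integers. -/
theorem IsIntegerLike.isIntegral (hφ : IsIntegerLike φ) {a : F}
    (ha : Polynomial.aeval a φ.charpoly = 0) :
    a ≠ 0 ∧ IsIntegral ℤ a ∧ IsIntegral ℤ a⁻¹ := by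
  obtain ⟨⟨p, hp⟩, hdet⟩ := hφ
  have hmonic : p.Monic := by
    have h1 := φ.charpoly_monic
    rw [← hp] at h1
    exact Polynomial.monic_of_injective (RingHom.injective_int _) h1
  have hpa : Polynomial.aeval a p = 0 := by
    rw [← hp] at ha
    rwa [Polynomial.aeval_def, Polynomial.eval₂_map, RingHom.ext_int
      ((algebraMap ℚ F).comp (Int.castRingHom ℚ)) (algebraMap ℤ F)] at ha
  have hint : IsIntegral ℤ a := ⟨p, hmonic, hpa⟩
  have hc : p.coeff 0 = 1 ∨ p.coeff 0 = -1 := by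
    have h1 : ((p.coeff 0 : ℤ) : ℚ) = φ.charpoly.coeff 0 := by
      rw [← hp, Polynomial.coeff_map]; rfl
    have h2 : φ.charpoly.coeff 0 ^ 2 = 1 := by
      have h4 := LinearMap.det_eq_sign_charpoly_coeff φ
      have h5 : LinearMap.det φ ^ 2 = 1 := by rcases hdet with h | h <;> rw [h] <;> norm_num
      rw [h4, mul_pow, ← pow_mul, mul_comm _ 2, pow_mul] at h5
      simpa using h5
    rw [← h1] at h2
    have h4 : (p.coeff 0) ^ 2 = 1 := by exact_mod_cast h2
    exact sq_eq_one_iff.1 h4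
  have hdiv : a * Polynomial.aeval a p.divX = -((p.coeff 0 : ℤ) : F) := by
    have h1 := congrArg (Polynomial.aeval a) p.divX_mul_X_add
    rw [hpa, map_add, map_mul, Polynomial.aeval_X, Polynomial.aeval_C] at h1
    rw [eq_intCast] at h1
    linear_combination h1
  have hq : IsIntegral ℤ (Polynomial.aeval a p.divX) := by
    have h1 := (Polynomial.aeval (⟨a, hint⟩ : integralClosure ℤ F) p.divX).2
    rwa [← Subalgebra.aeval_coe] at h1
  rcases hc with h | h <;> rw [h] at hdiv
  · have h1 : a * (-Polynomial.aeval a p.divX) = 1 := by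
      push_cast at hdiv; linear_combination -hdiv
    exact ⟨left_ne_zero_of_mul_eq_one h1, hint, by
      rw [inv_eq_of_mul_eq_one_right h1]; exact hq.neg⟩
  · have h1 : a * Polynomial.aeval a p.divX = 1 := by
      push_cast at hdiv; linear_combination hdiv
    exact ⟨left_ne_zero_of_mul_eq_one h1, hint, by
      rw [inv_eq_of_mul_eq_one_right h1]; exact hq⟩

/-- The eigenvalues of a hyperbolic map are not roots of unity. -/
theorem IsHyperbolicMap.pow_ne_one [Algebra.IsAlgebraic ℚ F] (hφ : IsHyperbolicMap φ) {a : F}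
    (ha : Polynomial.aeval a φ.charpoly = 0) {m : ℕ} (hm : 0 < m) : a ^ m ≠ 1 := by
  intro h
  let e : F →ₐ[ℚ] ℂ := IsAlgClosed.lift
  refine hφ (e a) ?_ ?_
  · rw [Polynomial.aeval_algHom_apply, ha, map_zero]
  · have h1 : ‖e a‖ ^ m = 1 := by rw [← norm_pow, ← map_pow, h, map_one, norm_one]
    exact (pow_eq_one_iff_of_nonneg (norm_nonneg _) hm.ne').1 h1

theorem not_hasEigenvalue_of_isHyperbolicMap (h1 : IsHyperbolicMap φ) (h2 : IsIntegerLike φ)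
    (c : ℚ) : ¬ φ.HasEigenvalue c := by
  intro hc
  rw [End.hasEigenvalue_iff_isRoot_charpoly] at hc
  have hc' : Polynomial.aeval c φ.charpoly = 0 := by
    rwa [Polynomial.coe_aeval_eq_eval]
  obtain ⟨h0, h4, h5⟩ := h2.isIntegral hc'
  exact h1.pow_ne_one hc' two_pos (sq_eq_one_of_isIntegral (F := ℚ) h4 h5 h0)

theorem prod_sq_eq_one (h2 : IsIntegerLike φ) {n : ℕ} {μ : Fin n → F}
    (hμ : ∀ j, Polynomial.aeval (μ j) φ.charpoly = 0) {d : ℚ}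
    (hd : ∏ j, μ j = algebraMap ℚ F d) : (∏ j, μ j) ^ 2 = 1 := by
  have h0 : d ≠ 0 := by
    rintro rfl
    rw [map_zero, Finset.prod_eq_zero_iff] at hd
    obtain ⟨j, -, hj⟩ := hd
    exact (h2.isIntegral (hμ j)).1 hj
  have h1 : IsIntegral ℤ (∏ j, μ j) := IsIntegral.prod _ fun j _ => (h2.isIntegral (hμ j)).2.1
  have h4 : IsIntegral ℤ (∏ j, μ j)⁻¹ := by
    rw [← Finset.prod_inv_distrib]
    exact IsIntegral.prod _ fun j _ => (h2.isIntegral (hμ j)).2.2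
  rw [hd] at h1 h4 ⊢
  rw [← map_pow, sq_eq_one_of_isIntegral h1 h4 h0, map_one]

end Arithmetic

/-! ### Galois conjugates -/

section Galois

variable {K F : Type*} [Field K] [Field F] [Algebra K F] [IsAlgClosed F] [Algebra.IsAlgebraic K F]

theorem exists_algEquiv_of_irreducible {p : Polynomial K} (hp : Irreducible p) (hm : p.Monic)
    {x y : F} (hx : Polynomial.aeval x p = 0) (hy : Polynomial.aeval y p = 0) :
    ∃ τ : F ≃ₐ[K] F, τ x = y := by
  have : IsAlgClosure K F := ⟨inferInstance, inferInstance⟩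
  refine minpoly.exists_algEquiv_of_root' (Algebra.IsAlgebraic.isAlgebraic x) ?_
  rwa [← minpoly.eq_of_irreducible_of_monic hp hx hm]

/-- An irreducible cubic stays irreducible over a quadratic field, so its roots are permuted
transitively by the automorphisms fixing a quadratic irrationality. -/
theorem exists_algEquiv_of_cubic_of_quadratic {p q : Polynomial K} (hp : Irreducible p)
    (hpm : p.Monic) (hp3 : p.natDegree = 3) (hq : Irreducible q) (hqm : q.Monic)
    (hq2 : q.natDegree = 2) {a x y : F} (ha : Polynomial.aeval a q = 0)
    (hx : Polynomial.aeval x p = 0) (hy : Polynomial.aeval y p = 0) :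
    ∃ τ : F ≃ₐ[K] F, τ a = a ∧ τ x = y := by
  have haint : IsIntegral K a := Algebra.IsIntegral.isIntegral a
  have hfin : finrank K (IntermediateField.adjoin K {a}) = 2 := by
    rw [IntermediateField.adjoin.finrank haint, ← minpoly.eq_of_irreducible_of_monic hq ha hqm, hq2]
  have : FiniteDimensional K (IntermediateField.adjoin K {a}) :=
    IntermediateField.adjoin.finiteDimensional haint
  set k := IntermediateField.adjoin K {a}
  have hirr : Irreducible (p.map (algebraMap K k)) := by
    refine Polynomial.irreducible_of_degree_le_three_of_not_isRoot ?_ fun e he => ?_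
    · rw [Polynomial.natDegree_map, hp3]; decide
    · have h1 : Polynomial.aeval e p = 0 := by
        rwa [Polynomial.IsRoot.def, Polynomial.eval_map_algebraMap] at he
      have h2 := minpoly.natDegree_le (A := K) e
      rw [← minpoly.eq_of_irreducible_of_monic hp h1 hpm, hp3, hfin] at h2
      omega
  have : Algebra.IsAlgebraic k F := Algebra.IsAlgebraic.tower_top (K := K) k
  have hmap : ∀ z : F, Polynomial.aeval z p = 0 →
      Polynomial.aeval z (p.map (algebraMap K k)) = 0 := fun z hz => by
    rwa [Polynomial.aeval_map_algebraMap]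
  obtain ⟨τ, hτ⟩ := exists_algEquiv_of_irreducible hirr (hpm.map _) (hmap x hx) (hmap y hy)
  refine ⟨τ.restrictScalars K, ?_, hτ⟩
  exact τ.commutes ⟨a, IntermediateField.mem_adjoin_simple_self K a⟩

end Galois

/-! ### The Galois action on `F ⊗ L` -/

section Conjugation

open scoped TensorProduct

variable {K F L : Type*} [Field K] [Field F] [Algebra K F] [LieRing L] [LieAlgebra K L]

/-- The action of a field automorphism on the coefficients of `F ⊗ L`. -/
noncomputable def conjTensor (τ : F ≃ₐ[K] F) : F ⊗[K] L →ₗ[K] F ⊗[K] L :=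
  τ.toLinearMap.rTensor L

@[simp]
theorem conjTensor_tmul (τ : F ≃ₐ[K] F) (a : F) (x : L) :
    conjTensor τ (a ⊗ₜ[K] x) = τ a ⊗ₜ x := rfl

theorem conjTensor_smul (τ : F ≃ₐ[K] F) (a : F) (m : F ⊗[K] L) :
    conjTensor τ (a • m) = τ a • conjTensor τ m := by
  induction m using TensorProduct.induction_on with
  | zero => simp
  | tmul c x => simp [TensorProduct.smul_tmul']
  | add x y hx hy => rw [smul_add, map_add, hx, hy, map_add, smul_add]

theorem conjTensor_lie (τ : F ≃ₐ[K] F) (m m' : F ⊗[K] L) :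
    conjTensor τ ⁅m, m'⁆ = ⁅conjTensor τ m, conjTensor τ m'⁆ := by
  induction m using TensorProduct.induction_on with
  | zero => simp
  | tmul c x =>
    induction m' using TensorProduct.induction_on with
    | zero => simp
    | tmul d y => simp
    | add x y hx hy => rw [lie_add, map_add, hx, hy, map_add, lie_add]
  | add x y hx hy => rw [add_lie, map_add, hx, hy, map_add, add_lie]

theorem conjTensor_baseChange (τ : F ≃ₐ[K] F) (φ : End K L) (m : F ⊗[K] L) :
    conjTensor τ (φ.baseChange F m) = φ.baseChange F (conjTensor τ m) := by
  induction m using TensorProduct.induction_on with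
  | zero => simp
  | tmul c x => simp
  | add x y hx hy => simp only [map_add, hx, hy]

theorem conjTensor_symm_apply (τ : F ≃ₐ[K] F) (m : F ⊗[K] L) :
    conjTensor τ.symm (conjTensor τ m) = m := by
  induction m using TensorProduct.induction_on with
  | zero => simp
  | tmul c x => simp
  | add x y hx hy => simp only [map_add, hx, hy]

theorem conjTensor_mem_lowerCentralSeries (τ : F ≃ₐ[K] F) (k : ℕ) {m : F ⊗[K] L}
    (hm : m ∈ lowerCentralSeries F (F ⊗[K] L) (F ⊗[K] L) k) :
    conjTensor τ m ∈ lowerCentralSeries F (F ⊗[K] L) (F ⊗[K] L) k := by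
  rw [LieSubmodule.lowerCentralSeries_tensor_eq_baseChange, LieSubmodule.mem_baseChange_iff] at hm ⊢
  induction hm using Submodule.span_induction with
  | mem y hy =>
    obtain ⟨y, hy, rfl⟩ := hy
    exact Submodule.subset_span ⟨y, hy, by simp⟩
  | zero => simp
  | add a b _ _ ha hb => rw [map_add]; exact add_mem ha hb
  | smul a b _ hb => rw [conjTensor_smul]; exact Submodule.smul_mem _ _ hb

theorem conjTensor_mem_maxGenEigenspace (τ : F ≃ₐ[K] F) {φ : End K L} {a : F} {m : F ⊗[K] L}
    (hm : m ∈ End.maxGenEigenspace (φ.baseChange F) a) :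
    conjTensor τ m ∈ End.maxGenEigenspace (φ.baseChange F) (τ a) := by
  rw [End.mem_maxGenEigenspace] at hm ⊢
  obtain ⟨k, hk⟩ := hm
  refine ⟨k, ?_⟩
  have key : ∀ (k : ℕ) (m : F ⊗[K] L), conjTensor τ (((φ.baseChange F - a • 1 :
      End F (F ⊗[K] L)) ^ k) m) =
      ((φ.baseChange F - τ a • 1 : End F (F ⊗[K] L)) ^ k) (conjTensor τ m) := by
    intro k
    induction k with
    | zero => simp
    | succ k ih =>
      intro m
      rw [pow_succ, pow_succ, End.mul_apply, End.mul_apply, ih]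
      simp only [LinearMap.sub_apply, LinearMap.smul_apply, End.one_apply, map_sub,
        conjTensor_baseChange, conjTensor_smul]
  rw [← key, hk, map_zero]

end Conjugation

/-! ### Connected pairs of eigenvalues -/

section Pairing

variable {F M : Type*} [Field F] [LieRing M] [LieAlgebra F M]

/-- The eigenvalue `b` of `f` on `γ₂` is connected to the eigenvalue `a` on `γ₃` by a nonzero
bracket. -/
def IsPaired (f : End F M) (a b : F) : Prop :=
  ∃ x ∈ f.maxGenEigenspace (a / b), ∃ y ∈ lowerCentralSeries F M M 1,
    y ∈ f.maxGenEigenspace b ∧ ⁅x, y⁆ ≠ 0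

open scoped TensorProduct in
theorem IsPaired.conj {K L : Type*} [Field K] [Algebra K F] [LieRing L] [LieAlgebra K L]
    {φ : End K L} {a b : F} (h : IsPaired (φ.baseChange F) a b) (τ : F ≃ₐ[K] F) :
    IsPaired (M := F ⊗[K] L) (φ.baseChange F) (τ a) (τ b) := by
  obtain ⟨x, hx, y, hy, hyb, hxy⟩ := h
  refine ⟨conjTensor τ x, ?_, conjTensor τ y, conjTensor_mem_lowerCentralSeries τ 1 hy,
    conjTensor_mem_maxGenEigenspace τ hyb, fun h0 => hxy ?_⟩
  · rw [← map_div₀]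
    exact conjTensor_mem_maxGenEigenspace τ hx
  · rw [← conjTensor_symm_apply τ ⁅x, y⁆, conjTensor_lie, h0, map_zero]

namespace EigenFrame

variable {f : End F M} {n : ℕ} (E : EigenFrame f n)

include E

theorem Y_ne_zero (j : Fin 2) : E.Y j ≠ 0 := fun h =>
  E.Y_notMem j (by rw [h]; exact zero_mem _)

theorem hasEigenvalue_μ (j : Fin 2) : f.HasEigenvalue (E.μ j) :=
  hasEigenvalue_of_mem_maxGenEigenspace (E.Y_gen j) (E.Y_ne_zero j)

theorem hasEigenvalue_ν (i : Fin n) : f.HasEigenvalue (E.ν i) :=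
  End.hasEigenvalue_of_hasEigenvector
    (End.hasEigenvector_iff.2 ⟨End.mem_eigenspace_iff.2 (E.Z_eigen i), E.Z_ne_zero i⟩)

theorem exists_lie_Y_eq_smul (hf : ∀ x y, f ⁅x, y⁆ = ⁅f x, f y⁆) {a : F} {x : M}
    (hx : x ∈ f.maxGenEigenspace a) {j : Fin 2} (hμ : E.μ j ≠ 0) (h0 : ⁅x, E.Y j⁆ ≠ 0) :
    ∃ i, ∃ c : F, a * E.μ j = E.ν i ∧ c ≠ 0 ∧ ⁅x, E.Y j⁆ = c • E.Z i ∧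
      IsPaired f (E.ν i) (E.μ j) := by
  obtain ⟨i, c, hi, hc, hxc⟩ := E.exists_eq_smul_Z (lie_mem_lowerCentralSeries_succ x (E.Y_mem j))
    (lie_mem_maxGenEigenspace hf hx (E.Y_gen j)) h0
  refine ⟨i, c, hi.symm, hc, hxc, x, ?_, E.Y j, E.Y_mem j, E.Y_gen j, h0⟩
  rwa [hi, mul_div_cancel_right₀ _ hμ]

/-- As `γ₃` is generated by brackets, some pair of eigenvalues is connected. -/
theorem exists_isPaired [IsAlgClosed F] [FiniteDimensional F M]
    (hf : ∀ x y, f ⁅x, y⁆ = ⁅f x, f y⁆) (h3 : lowerCentralSeries F M M 3 = ⊥)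
    (hμ : ∀ j, E.μ j ≠ 0) (i₀ : Fin n) : ∃ i j, IsPaired f (E.ν i) (E.μ j) := by
  by_contra! hcon
  have h1 : ∀ (j : Fin 2) (x : M), ⁅x, E.Y j⁆ = 0 := by
    intro j x
    have h2 : (⊤ : Submodule F M) ≤ LinearMap.ker (LieAlgebra.ad F M (E.Y j) : End F M) := by
      rw [← End.iSup_maxGenEigenspace_eq_top f]
      refine iSup_le fun a x hx => ?_
      have h4 : ⁅x, E.Y j⁆ = 0 := by
        by_contra h0
        obtain ⟨i, -, -, -, -, h⟩ := E.exists_lie_Y_eq_smul hf hx (hμ j) h0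
        exact hcon i j h
      rw [LinearMap.mem_ker]
      change ⁅E.Y j, x⁆ = 0
      rw [← lie_skew, h4, neg_zero]
    have h4 : ⁅E.Y j, x⁆ = 0 := h2 (Submodule.mem_top (x := x))
    rw [← lie_skew, h4, neg_zero]
  have h2 : E.Z i₀ ∈ (⊥ : Submodule F M) := lowerCentralSeries_succ_le (k := 1)
    (fun x y hy => by
      rw [Submodule.mem_bot]
      exact E.lie_eq_zero_of_forall_Y h3 (fun j => h1 j x) y hy) (E.Z_mem i₀)
  exact E.Z_ne_zero i₀ h2

/-- A connected pair `(ν i, μ j)` is realized by a generalized eigenvector that pairs to zero with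
the other `Y j'`, provided the eigenvalues do not coincide accidentally. -/
theorem exists_dual_of_isPaired (hf : ∀ x y, f ⁅x, y⁆ = ⁅f x, f y⁆)
    (h3 : lowerCentralSeries F M M 3 = ⊥) (hμ : ∀ j, E.μ j ≠ 0) {i : Fin n} {j : Fin 2}
    (h : IsPaired f (E.ν i) (E.μ j))
    (hdist : ∀ k j', j ≠ j' → E.ν i * E.μ j' ≠ E.ν k * E.μ j) :
    ∃ x ∈ f.maxGenEigenspace (E.ν i / E.μ j),
      ∀ j', ⁅x, E.Y j'⁆ = if j = j' then E.Z i else 0 := by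
  obtain ⟨x, hx, y, hy, hyj, hxy⟩ := h
  have hoff : ∀ j', j ≠ j' → ⁅x, E.Y j'⁆ = 0 := by
    intro j' hj'
    by_contra h0
    obtain ⟨k, -, hk, -⟩ := E.exists_lie_Y_eq_smul hf hx (hμ j') h0
    refine hdist k j' hj' ?_
    rw [← hk]
    field_simp [hμ j]
  have hj0 : ⁅x, E.Y j⁆ ≠ 0 := by
    intro h0
    refine hxy (E.lie_eq_zero_of_forall_Y h3 (fun j' => ?_) y hy)
    by_cases hjj : j = j'
    · rw [← hjj, h0]
    · exact hoff j' hjj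
  obtain ⟨k, c, hk, hc, hxc, -⟩ := E.exists_lie_Y_eq_smul hf hx (hμ j) hj0
  rw [div_mul_cancel₀ _ (hμ j)] at hk
  obtain rfl := E.ν_inj hk
  refine ⟨c⁻¹ • x, Submodule.smul_mem _ _ hx, fun j' => ?_⟩
  by_cases hjj : j = j'
  · subst hjj
    rw [if_pos rfl, smul_lie, hxc, smul_smul, inv_mul_cancel₀ hc, one_smul]
  · rw [if_neg hjj, smul_lie, hoff j' hjj, smul_zero]

end EigenFrame

end Pairing

/-! ### Existence of adapted frames -/

section FrameExistence

open scoped TensorProduct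

variable {F L : Type*} [Field F] [Algebra ℚ F] [LieRing L] [LieAlgebra ℚ L]

theorem mem_lowerCentralSeries_tensor {k : ℕ} {m : F ⊗[ℚ] L} :
    m ∈ lowerCentralSeries F (F ⊗[ℚ] L) (F ⊗[ℚ] L) k ↔
      m ∈ (lowerCentralSeries ℚ L L k).toSubmodule.baseChange F := by
  rw [LieSubmodule.lowerCentralSeries_tensor_eq_baseChange]
  rfl

theorem lowerCentralSeries_tensor_eq_bot {k : ℕ} (h : lowerCentralSeries ℚ L L k = ⊥) :
    lowerCentralSeries F (F ⊗[ℚ] L) (F ⊗[ℚ] L) k = ⊥ := by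
  rw [LieSubmodule.lowerCentralSeries_tensor_eq_baseChange, h, LieSubmodule.baseChange_bot]

theorem baseChange_lie {φ : End ℚ L} (hφ : ∀ x y, φ ⁅x, y⁆ = ⁅φ x, φ y⁆) (m m' : F ⊗[ℚ] L) :
    φ.baseChange F ⁅m, m'⁆ = ⁅φ.baseChange F m, φ.baseChange F m'⁆ := by
  induction m using TensorProduct.induction_on with
  | zero => simp
  | tmul c x =>
    induction m' using TensorProduct.induction_on with
    | zero => simp
    | tmul d y => simp [hφ]
    | add x y hx hy => rw [lie_add, map_add, hx, hy, map_add, lie_add]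
  | add x y hx hy => rw [add_lie, map_add, hx, hy, map_add, add_lie]

variable [Module.Finite ℚ L]

theorem aeval_charpoly_of_hasEigenvalue {φ : End ℚ L} {a : F}
    (ha : End.HasEigenvalue (φ.baseChange F) a) : Polynomial.aeval a φ.charpoly = 0 := by
  rwa [End.hasEigenvalue_iff_isRoot_charpoly, LinearMap.charpoly_baseChange,
    Polynomial.IsRoot.def, Polynomial.eval_map_algebraMap] at ha

/-- An Anosov automorphism of an algebra of type `(_, 2, n)`, `n ≤ 3`, has an adapted frame over the
algebraic closure; the eigenvalues on `γ₂ / γ₃` and on `γ₃` are full sets of conjugates, with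
product `±1`. -/
theorem exists_eigenFrame [IsAlgClosed F] {φ : End ℚ L}
    (hφ : ∀ x y, φ ⁅x, y⁆ = ⁅φ x, φ y⁆) (hh : IsHyperbolicMap φ) (hi : IsIntegerLike φ)
    (h3 : lowerCentralSeries ℚ L L 3 = ⊥) (ht1 : lieTypeEntry ℚ L 1 = 2) {n : ℕ} (hn1 : 1 ≤ n)
    (hn3 : n ≤ 3) (ht2 : lieTypeEntry ℚ L 2 = n) :
    ∃ E : EigenFrame (M := F ⊗[ℚ] L) (φ.baseChange F) n,
      (∃ q : Polynomial ℚ, Irreducible q ∧ q.Monic ∧ q.natDegree = 2 ∧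
        ∀ a, Polynomial.aeval a q = 0 ↔ ∃ j, E.μ j = a) ∧
      (∃ p : Polynomial ℚ, Irreducible p ∧ p.Monic ∧ p.natDegree = n ∧
        ∀ a, Polynomial.aeval a p = 0 ↔ ∃ i, E.ν i = a) ∧
      (∏ j, E.μ j) ^ 2 = 1 ∧ (∏ i, E.ν i) ^ 2 = 1 := by
  have hev := not_hasEigenvalue_of_isHyperbolicMap hh hi
  have hk := map_mem_lowerCentralSeries hφ
  obtain ⟨q, hq, hqm, hq2, μ, hμ, hqμ, ⟨d, hd⟩, Y, hY, hYe, hYg, hYs, hYi⟩ :=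
    exists_eigenvectors_quotient (F := F) (hk 1) (hk 2) hev (by norm_num) (by norm_num) ht1
  obtain ⟨p, hp, hpm, hpn, ν, hν, hpν, ⟨e, he⟩, Z, hZ, hZe, -, hZs, hZi⟩ :=
    exists_eigenvectors_quotient (F := F) (hk 2) (hk 3) hev hn1 hn3 ht2
  simp only [h3, LieSubmodule.bot_toSubmodule, Submodule.baseChange_bot, Submodule.mem_bot,
    sub_eq_zero] at hZe hZs hZi
  let E : EigenFrame (M := F ⊗[ℚ] L) (φ.baseChange F) n :=
    { ν := ν
      μ := μ
      Z := Z
      Y := Y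
      ν_inj := hν
      μ_inj := hμ
      Z_eigen := hZe
      Z_indep := Fintype.linearIndependent_iff.2 fun c hc i => congrFun (hZi c hc) i
      Z_span := by
        refine le_antisymm (Submodule.span_le.2 ?_) fun z hz => ?_
        · rintro _ ⟨i, rfl⟩
          exact mem_lowerCentralSeries_tensor.2 (hZ i)
        · obtain ⟨c, hc⟩ := hZs z (mem_lowerCentralSeries_tensor.1 hz)
          exact (Submodule.mem_span_range_iff_exists_fun F).2 ⟨c, hc.symm⟩
      Y_mem := fun j => mem_lowerCentralSeries_tensor.2 (hY j)
      Y_eigen := fun j => mem_lowerCentralSeries_tensor.2 (hYe j)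
      Y_gen := hYg
      Y_span := fun y hy => by
        obtain ⟨c, hc⟩ := hYs y (mem_lowerCentralSeries_tensor.1 hy)
        exact ⟨c, mem_lowerCentralSeries_tensor.2 hc⟩
      Y_indep := fun c hc => hYi c (mem_lowerCentralSeries_tensor.1 hc) }
  exact ⟨E, ⟨q, hq, hqm, hq2, hqμ⟩, ⟨p, hp, hpm, hpn, hpν⟩,
    prod_sq_eq_one hi (fun j => aeval_charpoly_of_hasEigenvalue (E.hasEigenvalue_μ j)) hd,
    prod_sq_eq_one hi (fun i => aeval_charpoly_of_hasEigenvalue (E.hasEigenvalue_ν i)) he⟩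

end FrameExistence

theorem exists_conj_eq {F : Type*} [Field F] [Algebra ℚ F] {p : Polynomial ℚ} {ι : Type*}
    {ν : ι → F} (hp : ∀ a, Polynomial.aeval a p = 0 ↔ ∃ i, ν i = a) (τ : F ≃ₐ[ℚ] F) (i : ι) :
    ∃ k, ν k = τ (ν i) := by
  rw [← hp]
  have h := Polynomial.aeval_algHom_apply (τ : F →ₐ[ℚ] F) (ν i) p
  rw [(hp _).2 ⟨i, rfl⟩, map_zero] at h
  exact h

/-! ### Three dimensional `γ₃` -/

section CaseThree

open scoped TensorProduct

variable {F L : Type*} [Field F] [Algebra ℚ F] [IsAlgClosed F] [Algebra.IsAlgebraic ℚ F]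
  [LieRing L] [LieAlgebra ℚ L] [Module.Finite ℚ L]

/-- With three conjugate eigenvalues on `γ₃` and two on `γ₂ / γ₃` the Galois group is transitive on
pairs of eigenvalues, so that all pairs are connected, which is impossible. -/
theorem false_of_three {φ : End ℚ L} (hφ : ∀ x y, φ ⁅x, y⁆ = ⁅φ x, φ y⁆)
    (hh : IsHyperbolicMap φ) (h3 : lowerCentralSeries ℚ L L 3 = ⊥)
    (E : EigenFrame (M := F ⊗[ℚ] L) (φ.baseChange F) 3) {p q : Polynomial ℚ}
    (hq : Irreducible q) (hqm : q.Monic) (hq2 : q.natDegree = 2)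
    (hqμ : ∀ a, Polynomial.aeval a q = 0 ↔ ∃ j, E.μ j = a)
    (hp : Irreducible p) (hpm : p.Monic) (hp3 : p.natDegree = 3)
    (hpν : ∀ a, Polynomial.aeval a p = 0 ↔ ∃ i, E.ν i = a)
    (hμ1 : (∏ j, E.μ j) ^ 2 = 1) (hν1 : (∏ i, E.ν i) ^ 2 = 1) : False := by
  have h3' := lowerCentralSeries_tensor_eq_bot (F := F) h3
  have hf := baseChange_lie (F := F) hφ
  have hμ0 : ∀ j, E.μ j ≠ 0 := fun j h => by
    rw [Finset.prod_eq_zero (Finset.mem_univ j) h] at hμ1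
    simp at hμ1
  have hν0 : ∏ i, E.ν i ≠ 0 := fun h => by
    rw [h] at hν1
    simp at hν1
  have hpair : ∀ i j k l, ∃ τ : F ≃ₐ[ℚ] F, τ (E.ν i) = E.ν k ∧ τ (E.μ j) = E.μ l := by
    intro i j k l
    obtain ⟨τ, hτ⟩ := exists_algEquiv_of_irreducible hq hqm ((hqμ _).2 ⟨j, rfl⟩)
      ((hqμ _).2 ⟨l, rfl⟩)
    obtain ⟨m, hm⟩ := exists_conj_eq hpν τ i
    obtain ⟨σ, hσ1, hσ2⟩ := exists_algEquiv_of_cubic_of_quadratic hp hpm hp3 hq hqm hq2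
      ((hqμ _).2 ⟨l, rfl⟩) ((hpν _).2 ⟨m, rfl⟩) ((hpν _).2 ⟨k, rfl⟩)
    exact ⟨τ.trans σ, by rw [AlgEquiv.trans_apply, ← hm, hσ2],
      by rw [AlgEquiv.trans_apply, hτ, hσ1]⟩
  -- if `ν i / ν k = μ j / μ j'` then multiplication by this number permutes the three `ν`s
  have hdist : ∀ i j k j', j ≠ j' → E.ν i * E.μ j' ≠ E.ν k * E.μ j := by
    intro i j k j' hjj h
    set r := E.μ j' / E.μ j with hr
    have hfix : ∀ τ : F ≃ₐ[ℚ] F, τ (E.μ j) = E.μ j → τ r = r := by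
      intro τ hτ
      obtain ⟨l, hl⟩ := exists_conj_eq hqμ τ j'
      have hlj : l = j' := by
        have : l ≠ j := fun h' => hjj (E.μ_inj (τ.injective (by rw [← hl, hτ, h'])))
        omega
      rw [hr, map_div₀, hτ, ← hl, hlj]
    have hki : E.ν k = r * E.ν i := by
      rw [hr]
      field_simp [hμ0 j]
      linear_combination -h
    have hmul : ∀ l, ∃ m, E.ν m = r * E.ν l := by
      intro l
      obtain ⟨τ, hτν, hτμ⟩ := hpair i j l j
      obtain ⟨m, hm⟩ := exists_conj_eq hpν τ k
      exact ⟨m, by rw [hm, hki, map_mul, hfix τ hτμ, hτν]⟩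
    choose s hs using hmul
    have hr0 : r ≠ 0 := div_ne_zero (hμ0 _) (hμ0 _)
    have hsinj : Function.Injective s := fun a b hab =>
      E.ν_inj (mul_left_cancel₀ hr0 (by rw [← hs, ← hs, hab]))
    have hprod : ∏ l, E.ν l = r ^ 3 * ∏ l, E.ν l := by
      calc ∏ l, E.ν l = ∏ l, E.ν (s l) :=
            ((Finite.injective_iff_bijective.1 hsinj).prod_comp _).symm
        _ = r ^ 3 * ∏ l, E.ν l := by simp [hs, Finset.prod_mul_distrib]
    have hr3 : r ^ 3 = 1 := mul_right_cancel₀ hν0 (by rw [← hprod, one_mul])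
    have hμj : E.μ j' = r * E.μ j := by rw [hr, div_mul_cancel₀ _ (hμ0 j)]
    have hjj1 : (E.μ j * E.μ j') ^ 2 = 1 := by
      rw [Fin.prod_univ_two] at hμ1
      have : (j = 0 ∧ j' = 1) ∨ (j = 1 ∧ j' = 0) := by omega
      rcases this with ⟨rfl, rfl⟩ | ⟨rfl, rfl⟩
      · exact hμ1
      · rwa [mul_comm]
    refine hh.pow_ne_one (aeval_charpoly_of_hasEigenvalue (E.hasEigenvalue_μ j))
      (m := 12) (by norm_num) ?_
    rw [hμj] at hjj1
    have h1 : (E.μ j ^ 4 * r ^ 2) ^ 3 = 1 := by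
      have : E.μ j ^ 4 * r ^ 2 = 1 := by linear_combination hjj1
      rw [this, one_pow]
    have h2 : (E.μ j ^ 4 * r ^ 2) ^ 3 = E.μ j ^ 12 * (r ^ 3) ^ 2 := by ring
    rw [h2, hr3, one_pow, mul_one] at h1
    exact h1
  obtain ⟨i₀, j₀, h0⟩ := E.exists_isPaired hf h3' hμ0 0
  have hall : ∀ i j, IsPaired (M := F ⊗[ℚ] L) (φ.baseChange F) (E.ν i) (E.μ j) := by
    intro i j
    obtain ⟨τ, hτ1, hτ2⟩ := hpair i₀ j₀ i j
    rw [← hτ1, ← hτ2]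
    exact h0.conj τ
  choose X _ hX using fun i j => E.exists_dual_of_isPaired hf h3' hμ0 (hall i j)
    (fun k j' => hdist i j k j')
  exact E.false_of_forall_pairs h3' (by norm_num) hX fun i j k l hik => Or.inl (by
    fin_cases i <;> fin_cases k <;> simp at hik <;> decide)

end CaseThree

/-! ### Two dimensional `γ₃`: only two pairs are connected -/

section CaseTwo

namespace EigenFrame

variable {F M : Type*} [Field F] [LieRing M] [LieAlgebra F M] {f : End F M}

/-- Renumber the basis of `γ₃`. -/
def reindex {n : ℕ} (E : EigenFrame f n) (e : Equiv.Perm (Fin n)) : EigenFrame f n :=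
  { E with
    ν := E.ν ∘ e
    Z := E.Z ∘ e
    ν_inj := E.ν_inj.comp e.injective
    Z_eigen := fun i => E.Z_eigen (e i)
    Z_indep := E.Z_indep.comp e e.injective
    Z_span := by rw [e.surjective.range_comp, E.Z_span] }

variable (E : EigenFrame f 2)

/-- An accidental coincidence `ν i / μ j = ν k / μ j'` would make this eigenvalue a root of
unity. -/
theorem ne_of_isPaired (hroot : ∀ a, f.HasEigenvalue a → ∀ m : ℕ, 0 < m → a ^ m ≠ 1)
    (hμ : ∀ i k, i ≠ k → (E.μ i * E.μ k) ^ 2 = 1) (hν : ∀ i k, i ≠ k → (E.ν i * E.ν k) ^ 2 = 1)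
    (hμ0 : ∀ j, E.μ j ≠ 0) (hν0 : ∀ j, E.ν j ≠ 0) {i j : Fin 2}
    (h : IsPaired f (E.ν i) (E.μ j)) (k j' : Fin 2) (hj : j ≠ j') :
    E.ν i * E.μ j' ≠ E.ν k * E.μ j := by
  intro heq
  by_cases hik : i = k
  · subst hik
    exact hj (E.μ_inj (mul_left_cancel₀ (hν0 i) heq)).symm
  · obtain ⟨x, hx, y, -, -, hxy⟩ := h
    refine hroot _ (hasEigenvalue_of_mem_maxGenEigenspace hx fun h0 => hxy ?_) 4 (by norm_num) ?_
    · rw [h0, zero_lie]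
    · have h1 : E.ν i / E.μ j = E.ν k / E.μ j' := by
        rw [div_eq_div_iff (hμ0 _) (hμ0 _), heq]
      have h2 : (E.ν i / E.μ j) ^ 4 = ((E.ν i / E.μ j) * (E.ν k / E.μ j')) ^ 2 := by
        rw [← h1]; ring
      rw [h2, div_mul_div_comm, div_pow, hν i k hik, hμ j j' hj, div_one]

/-- In type `(_, 2, 2)` not all pairs of eigenvalues are connected. -/
theorem false_of_forall_isPaired (hf : ∀ x y, f ⁅x, y⁆ = ⁅f x, f y⁆)
    (hroot : ∀ a, f.HasEigenvalue a → ∀ m : ℕ, 0 < m → a ^ m ≠ 1)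
    (h3 : lowerCentralSeries F M M 3 = ⊥)
    (hμ : ∀ i k, i ≠ k → (E.μ i * E.μ k) ^ 2 = 1) (hν : ∀ i k, i ≠ k → (E.ν i * E.ν k) ^ 2 = 1)
    (hμ0 : ∀ j, E.μ j ≠ 0) (hν0 : ∀ j, E.ν j ≠ 0)
    (hall : ∀ i j, IsPaired f (E.ν i) (E.μ j)) : False := by
  choose X hXl hX using fun i j => E.exists_dual_of_isPaired hf h3 hμ0 (hall i j)
    (E.ne_of_isPaired hroot hμ hν hμ0 hν0 (hall i j))
  refine E.false_of_forall_pairs h3 le_rfl hX fun i j k l hik => Or.inr ?_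
  -- otherwise `±1 / (μ j * μ l)` would be one of the two eigenvalues `μ p`
  by_contra hnot
  have hmem := lie_mem_maxGenEigenspace hf (hXl i j) (hXl k l)
  obtain ⟨c, z, hz, hc⟩ := E.exists_coord_Y (lie_mem_lowerCentralSeries_one (X i j) (X k l))
  obtain ⟨p, hp⟩ : ∃ p, c p ≠ 0 := by
    by_contra! h
    refine hnot ?_
    rw [hc]
    simpa only [h, zero_smul, Finset.sum_const_zero, zero_add] using hz
  rw [hc] at hmem
  have hμp := E.μ_eq_of_coord hf hz hmem hp
  have h1 : (E.μ p * (E.μ j * E.μ l)) ^ 2 = 1 := by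
    rw [hμp, div_mul_div_comm, div_mul_cancel₀ _ (mul_ne_zero (hμ0 j) (hμ0 l)), hν i k hik]
  by_cases hjl : j = l
  · subst hjl
    by_cases hpj : p = j
    · subst hpj
      exact hroot _ (E.hasEigenvalue_μ p) 6 (by norm_num) (by linear_combination h1)
    · exact hroot _ (E.hasEigenvalue_μ j) 2 two_pos
        (by linear_combination h1 - E.μ j ^ 2 * hμ p j hpj)
  · exact hroot _ (E.hasEigenvalue_μ p) 2 two_pos
      (by linear_combination h1 - E.μ p ^ 2 * hμ j l hjl)

variable [IsAlgClosed F] [FiniteDimensional F M]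

/-- If exactly the pairs `(ν i, μ i)` are connected, the span of `X 0` and `X 1` is a complement of
the centralizer of `γ₂`. -/
theorem exists_dual_of_diagonal (hf : ∀ x y, f ⁅x, y⁆ = ⁅f x, f y⁆)
    (hroot : ∀ a, f.HasEigenvalue a → ∀ m : ℕ, 0 < m → a ^ m ≠ 1)
    (h3 : lowerCentralSeries F M M 3 = ⊥)
    (hμ : ∀ i k, i ≠ k → (E.μ i * E.μ k) ^ 2 = 1) (hν : ∀ i k, i ≠ k → (E.ν i * E.ν k) ^ 2 = 1)
    (hμ0 : ∀ j, E.μ j ≠ 0) (hν0 : ∀ j, E.ν j ≠ 0)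
    (hpair : ∀ i j, IsPaired f (E.ν i) (E.μ j) ↔ i = j) :
    ∃ X : Fin 2 → M, (∀ i, X i ∈ f.maxGenEigenspace (E.ν i / E.μ i)) ∧
      (∀ i j, ⁅X i, E.Y j⁆ = if i = j then E.Z i else 0) ∧
      ∀ x, ∃ c : Fin 2 → F, x - ∑ i, c i • X i ∈ derivedCentralizer F M := by
  have hdiag : ∀ i, IsPaired f (E.ν i) (E.μ i) := fun i => (hpair i i).2 rfl
  choose X hXl hX using fun i => E.exists_dual_of_isPaired hf h3 hμ0 (hdiag i)
    (E.ne_of_isPaired hroot hμ hν hμ0 hν0 (hdiag i))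
  refine ⟨X, hXl, hX, fun x => ?_⟩
  have hx : ∀ j, ∃ c : F, ⁅x, E.Y j⁆ = c • E.Z j := by
    intro j
    have h2 : (⊤ : Submodule F M) ≤
        (Submodule.span F {E.Z j}).comap (LieAlgebra.ad F M (E.Y j) : End F M) := by
      rw [← End.iSup_maxGenEigenspace_eq_top f]
      refine iSup_le fun a w hw => ?_
      rw [Submodule.mem_comap]
      change ⁅E.Y j, w⁆ ∈ _
      rw [← lie_skew, neg_mem_iff]
      by_cases h0 : ⁅w, E.Y j⁆ = 0
      · rw [h0]; exact zero_mem _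
      · obtain ⟨i, c, -, -, hc, hij⟩ := E.exists_lie_Y_eq_smul hf hw (hμ0 j) h0
        rw [hc, (hpair i j).1 hij]
        exact Submodule.smul_mem _ _ (Submodule.mem_span_singleton_self _)
    have h4 : ⁅E.Y j, x⁆ ∈ Submodule.span F {E.Z j} := h2 (Submodule.mem_top (x := x))
    rw [← lie_skew, neg_mem_iff] at h4
    obtain ⟨c, hc⟩ := Submodule.mem_span_singleton.1 h4
    exact ⟨c, hc.symm⟩
  choose c hc using hx
  refine ⟨c, E.lie_eq_zero_of_forall_Y h3 fun j => ?_⟩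
  simp only [sub_lie, sum_lie, smul_lie, hX, hc, smul_ite, smul_zero, Finset.sum_ite_eq',
    Finset.mem_univ, if_true, sub_self]

end EigenFrame

end CaseTwo

/-! ### The derived core is abelian -/

section AbelianCore

variable {K L : Type*} [Field K] [LieRing L] [LieAlgebra K L] [FiniteDimensional K L]

theorem finrank_quotient_submoduleOf_add {N N' : Submodule K L} (h : N' ≤ N) :
    finrank K (N ⧸ N'.submoduleOf N) + finrank K N' = finrank K N := by
  rw [← (Submodule.submoduleOfEquivOfLe h).finrank_eq, Submodule.finrank_quotient_add_finrank]

/-- If the derived core has dimension two modulo `γ₂`, its brackets span at most a line, on which an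
automorphism without eigenvalues in the base field cannot act. -/
theorem lie_eq_zero_of_mem_derivedCore {φ : End K L} (hφ : ∀ x y, φ ⁅x, y⁆ = ⁅φ x, φ y⁆)
    (hsurj : Function.Surjective φ) (hev : ∀ c, ¬ φ.HasEigenvalue c)
    (h3 : lowerCentralSeries K L L 3 = ⊥)
    (hfin : finrank K (derivedCore K L) = finrank K (lowerCentralSeries K L L 1) + 2) :
    ∀ u ∈ derivedCore K L, ∀ v ∈ derivedCore K L, ⁅u, v⁆ = 0 := by
  set D := derivedCore K L
  set N := (lowerCentralSeries K L L 1).toSubmodule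
  have hND : N ≤ D := fun y hy => mem_derivedCore_of_mem_lowerCentralSeries_one h3 hy
  have hφD : ∀ u ∈ D, φ u ∈ D := fun u hu =>
    ⟨map_mem_derivedCentralizer hφ hsurj hu.1, fun x => by
      obtain ⟨x, rfl⟩ := hsurj x
      rw [← hφ]
      exact map_mem_lowerCentralSeries hφ 2 _ (hu.2 x)⟩
  have h2 : finrank K (D ⧸ N.submoduleOf D) = 2 := by
    have := finrank_quotient_submoduleOf_add hND
    change finrank K D = finrank K N + 2 at hfin
    omega
  set b := finBasisOfFinrankEq K (D ⧸ N.submoduleOf D) h2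
  choose d hd using fun i => Submodule.mkQ_surjective (N.submoduleOf D) (b i)
  have hsplit : ∀ u ∈ D, ∃ c : Fin 2 → K, ∃ y ∈ N,
      u = c 0 • (d 0 : L) + c 1 • (d 1 : L) + y := by
    intro u hu
    set c := b.repr ((N.submoduleOf D).mkQ ⟨u, hu⟩)
    have h1 : (N.submoduleOf D).mkQ (⟨u, hu⟩ - (c 0 • d 0 + c 1 • d 1)) = 0 := by
      rw [map_sub, map_add, map_smul, map_smul, hd, hd, sub_eq_zero, ← Fin.sum_univ_two
        (fun i => c i • b i), b.sum_repr]
    rw [Submodule.mkQ_apply, Submodule.Quotient.mk_eq_zero] at h1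
    exact ⟨c, _, h1, by simp⟩
  have hDN : ∀ u ∈ D, ∀ y ∈ N, ⁅u, y⁆ = 0 := fun u hu y hy => hu.1 y hy
  have hND' : ∀ y ∈ N, ∀ u ∈ D, ⁅y, u⁆ = 0 := fun y hy u hu => by
    rw [← lie_skew, hDN u hu y hy, neg_zero]
  have hdet : ∀ u ∈ D, ∀ v ∈ D, ∃ c : K, ⁅u, v⁆ = c • ⁅(d 0 : L), (d 1 : L)⁆ := by
    intro u hu v hv
    obtain ⟨a, y, hy, rfl⟩ := hsplit u hu
    obtain ⟨a', y', hy', rfl⟩ := hsplit v hv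
    have h10 : ⁅(d 1 : L), (d 0 : L)⁆ = -⁅(d 0 : L), (d 1 : L)⁆ := (lie_skew _ _).symm
    refine ⟨a 0 * a' 1 - a 1 * a' 0, ?_⟩
    rw [lie_add, hDN _ hu y' hy', add_zero, add_lie, hND' y hy _
      (D.add_mem (D.smul_mem _ (d 0).2) (D.smul_mem _ (d 1).2)), add_zero]
    simp only [add_lie, lie_add, smul_lie, lie_smul, lie_self, h10]
    module
  have hw : ⁅(d 0 : L), (d 1 : L)⁆ = 0 := by
    by_contra h0
    obtain ⟨c, hc⟩ := hdet _ (hφD _ (d 0).2) _ (hφD _ (d 1).2)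
    rw [← hφ] at hc
    exact hev c (End.hasEigenvalue_of_hasEigenvector
      (End.hasEigenvector_iff.2 ⟨End.mem_eigenspace_iff.2 hc, h0⟩))
  intro u hu v hv
  obtain ⟨c, hc⟩ := hdet u hu v hv
  rw [hc, hw, smul_zero]

end AbelianCore

/-! ### The grading in type `(6, 2, 2)` -/

section Type622

open scoped TensorProduct

theorem finrank_submodule_baseChange {K F V : Type*} [Field K] [Field F] [Algebra K F]
    [AddCommGroup V] [Module K V] (N : Submodule K V) :
    finrank F (N.baseChange F) = finrank K N := by
  have hinj : Function.Injective (N.subtype.baseChange F) :=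
    Module.Flat.lTensor_preserves_injective_linearMap _ N.injective_subtype
  rw [← Module.finrank_baseChange (R := F) (S := K) (M' := N)]
  exact LinearMap.finrank_range_of_inj hinj

variable {F L : Type*} [Field F] [Algebra ℚ F] [LieRing L] [LieAlgebra ℚ L]

/-- A nonempty proper subset of `Fin 2 × Fin 2` stable under a pair of permutations which swaps the
rows and under one which swaps the columns is the graph of a permutation. -/
theorem forall_iff_eq_or_forall_iff_swap {I : Fin 2 → Fin 2 → Prop} (hex : ∃ i j, I i j)
    (hnot : ¬ ∀ i j, I i j) {s t s' t' : Fin 2 → Fin 2} (hs : s 0 = 1 ∧ s 1 = 0)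
    (ht : t 0 ≠ t 1) (hst : ∀ i j, I i j → I (s i) (t j)) (ht' : t' 0 = 1 ∧ t' 1 = 0)
    (hs' : s' 0 ≠ s' 1) (hst' : ∀ i j, I i j → I (s' i) (t' j)) :
    (∀ i j, I i j ↔ i = j) ∨ ∀ i j, I i j ↔ Equiv.swap 0 1 i = j := by
  have ht2 : (t 0 = 0 ∧ t 1 = 1) ∨ (t 0 = 1 ∧ t 1 = 0) := by omega
  have hs2 : (s' 0 = 0 ∧ s' 1 = 1) ∨ (s' 0 = 1 ∧ s' 1 = 0) := by omega
  simp only [Fin.forall_fin_two, Fin.exists_fin_two, Equiv.swap_apply_left, hs, ht',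
    Equiv.swap_apply_right, zero_ne_one, one_ne_zero, iff_true, iff_false] at *
  rcases ht2 with ⟨a, b⟩ | ⟨a, b⟩ <;> rcases hs2 with ⟨c, d⟩ | ⟨c, d⟩ <;>
    simp only [a, b, c, d] at hst hst' <;> grind

/-- The Galois group acts transitively on the eigenvalues on `γ₃` and on those on `γ₂ / γ₃`, so
either all pairs are connected or exactly the pairs of a bijection are. -/
theorem exists_reindex_isPaired_iff {φ : End ℚ L}
    (E : EigenFrame (M := F ⊗[ℚ] L) (φ.baseChange F) 2)
    (hμ : ∀ j j', ∃ τ : F ≃ₐ[ℚ] F, τ (E.μ j) = E.μ j')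
    (hν : ∀ j j', ∃ τ : F ≃ₐ[ℚ] F, τ (E.ν j) = E.ν j')
    (hμ' : ∀ (τ : F ≃ₐ[ℚ] F) j, ∃ k, E.μ k = τ (E.μ j))
    (hν' : ∀ (τ : F ≃ₐ[ℚ] F) j, ∃ k, E.ν k = τ (E.ν j))
    (hex : ∃ i j, IsPaired (M := F ⊗[ℚ] L) (φ.baseChange F) (E.ν i) (E.μ j))
    (hnot : ¬ ∀ i j, IsPaired (M := F ⊗[ℚ] L) (φ.baseChange F) (E.ν i) (E.μ j)) :
    ∃ e : Equiv.Perm (Fin 2), ∀ i j,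
      IsPaired (M := F ⊗[ℚ] L) (φ.baseChange F) ((E.reindex e).ν i) ((E.reindex e).μ j) ↔
        i = j := by
  set I : Fin 2 → Fin 2 → Prop := fun i j =>
    IsPaired (M := F ⊗[ℚ] L) (φ.baseChange F) (E.ν i) (E.μ j) with hI
  -- an automorphism permutes rows and columns of the relation `I`
  have hact : ∀ τ : F ≃ₐ[ℚ] F, ∃ s t : Fin 2 → Fin 2, (∀ i, E.ν (s i) = τ (E.ν i)) ∧
      (∀ j, E.μ (t j) = τ (E.μ j)) ∧ s 0 ≠ s 1 ∧ t 0 ≠ t 1 ∧ ∀ i j, I i j → I (s i) (t j) := by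
    intro τ
    choose s hs using hν' τ
    choose t ht using hμ' τ
    refine ⟨s, t, hs, ht, fun h => ?_, fun h => ?_, fun i j hij => ?_⟩
    · have h1 : E.ν 0 = E.ν 1 := τ.injective (by rw [← hs, ← hs, h])
      exact absurd (E.ν_inj h1) (by decide)
    · have h1 : E.μ 0 = E.μ 1 := τ.injective (by rw [← ht, ← ht, h])
      exact absurd (E.μ_inj h1) (by decide)
    · simp only [hI, hs, ht]
      exact hij.conj τ
  obtain ⟨τ, hτ⟩ := hν 0 1
  obtain ⟨σ, hσ⟩ := hμ 0 1
  obtain ⟨s, t, hs, ht, hs01, ht01, hst⟩ := hact τ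
  obtain ⟨s', t', hs', ht', hs01', ht01', hst'⟩ := hact σ
  have hs0 : s 0 = 1 := E.ν_inj (by rw [hs, hτ])
  have ht0' : t' 0 = 1 := E.μ_inj (by rw [ht', hσ])
  have hdich : (∀ i j, I i j ↔ i = j) ∨ (∀ i j, I i j ↔ Equiv.swap 0 1 i = j) := by
    refine forall_iff_eq_or_forall_iff_swap hex hnot ⟨hs0, by omega⟩ ht01 hst
      ⟨ht0', by omega⟩ hs01' hst'
  rcases hdich with h | h
  · exact ⟨1, h⟩
  · refine ⟨Equiv.swap 0 1, fun i j => (h _ j).trans ?_⟩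
    rw [Equiv.swap_apply_self]

variable [IsAlgClosed F] [Algebra.IsAlgebraic ℚ F] [Module.Finite ℚ L]

/-- The positive grading in type `(6, 2, 2)`: of the hypotheses on the type, the last one says that
`L / γ₂` has dimension six. -/
theorem hasPositiveGrading_of_two {φ : End ℚ L} (hφ : ∀ x y, φ ⁅x, y⁆ = ⁅φ x, φ y⁆)
    (hsurj : Function.Surjective φ) (hh : IsHyperbolicMap φ) (hi : IsIntegerLike φ)
    (h3 : lowerCentralSeries ℚ L L 3 = ⊥)
    (E : EigenFrame (M := F ⊗[ℚ] L) (φ.baseChange F) 2) {p q : Polynomial ℚ}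
    (hq : Irreducible q) (hqm : q.Monic) (hqμ : ∀ a, Polynomial.aeval a q = 0 ↔ ∃ j, E.μ j = a)
    (hp : Irreducible p) (hpm : p.Monic) (hpν : ∀ a, Polynomial.aeval a p = 0 ↔ ∃ i, E.ν i = a)
    (hμ1 : (∏ j, E.μ j) ^ 2 = 1) (hν1 : (∏ i, E.ν i) ^ 2 = 1)
    (ht : finrank ℚ L = finrank ℚ (lowerCentralSeries ℚ L L 1) + 6) :
    HasPositiveGrading ℚ L := by
  have h3' := lowerCentralSeries_tensor_eq_bot (F := F) h3
  have hf := baseChange_lie (F := F) hφ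
  have hfsurj : Function.Surjective (φ.baseChange F) := LinearMap.lTensor_surjective F hsurj
  have hroot : ∀ a, End.HasEigenvalue (φ.baseChange F) a → ∀ m : ℕ, 0 < m → a ^ m ≠ 1 :=
    fun a ha m hm => hh.pow_ne_one (aeval_charpoly_of_hasEigenvalue ha) hm
  have hpair : ∀ {w : Fin 2 → F}, (∏ j, w j) ^ 2 = 1 → ∀ i k, i ≠ k → (w i * w k) ^ 2 = 1 := by
    intro w hw i k hik
    rw [Fin.prod_univ_two] at hw
    have : (i = 0 ∧ k = 1) ∨ (i = 1 ∧ k = 0) := by omega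
    rcases this with ⟨rfl, rfl⟩ | ⟨rfl, rfl⟩
    · exact hw
    · rwa [mul_comm]
  have hne : ∀ {w : Fin 2 → F}, (∏ j, w j) ^ 2 = 1 → ∀ j, w j ≠ 0 := fun hw j h => by
    rw [Finset.prod_eq_zero (Finset.mem_univ j) h] at hw
    simp at hw
  obtain ⟨e, he⟩ := exists_reindex_isPaired_iff E
    (fun j j' => exists_algEquiv_of_irreducible hq hqm ((hqμ _).2 ⟨j, rfl⟩) ((hqμ _).2 ⟨j', rfl⟩))
    (fun j j' => exists_algEquiv_of_irreducible hp hpm ((hpν _).2 ⟨j, rfl⟩) ((hpν _).2 ⟨j', rfl⟩))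
    (exists_conj_eq hqμ) (exists_conj_eq hpν) (E.exists_isPaired hf h3' (hne hμ1) 0)
    (E.false_of_forall_isPaired hf hroot h3' (hpair hμ1) (hpair hν1) (hne hμ1) (hne hν1))
  set E' := E.reindex e
  have hν1' : (∏ i, E'.ν i) ^ 2 = 1 := by
    rw [← hν1]
    exact congrArg (· ^ 2) (Equiv.prod_comp e E.ν)
  have hμ2 := hpair (w := E'.μ) hμ1
  have hμ0 := hne (w := E'.μ) hμ1
  obtain ⟨X, hXl, hX, hdec⟩ := E'.exists_dual_of_diagonal hf hroot h3' hμ2 (hpair hν1') hμ0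
    (hne hν1') he
  obtain ⟨hXX, U, a, hU, hUU, hoff, ha, hXU⟩ := E'.exists_partners hf hfsurj hroot h3' hμ2
    (hpair hν1') (fun i => div_mul_cancel₀ _ (hμ0 i)) hXl hX hdec
  obtain ⟨hli, hcompl⟩ := E'.isCompl_derivedCore h3' hX hXX hdec hU hoff ha hXU
  have hfin : finrank ℚ (derivedCore ℚ L) = finrank ℚ (lowerCentralSeries ℚ L L 1) + 2 := by
    have h1 := Submodule.finrank_add_eq_of_isCompl hcompl
    rw [finrank_span_eq_card hli, derivedCore_tensor, finrank_submodule_baseChange,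
      Module.finrank_baseChange, Fintype.card_sum, Fintype.card_fin] at h1
    omega
  have hDD := lie_eq_zero_of_mem_derivedCore_tensor (F := F)
    (lie_eq_zero_of_mem_derivedCore hφ hsurj (not_hasEigenvalue_of_isHyperbolicMap hh hi) h3 hfin)
  obtain ⟨δ, h4, h5, h6, h7⟩ := exists_derivation_descent
    (E'.exists_derivation h3' hX hXX hdec hU hUU hoff ha hXU hDD)
  exact hasPositiveGrading_of_derivation h4 h5 h6 h7

end Type622

/-! ### Reading off the type -/

section TypeEntries

variable {L : Type*} [LieRing L] [LieAlgebra ℚ L]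

theorem lieType_eq_three (hnil : LieRing.IsNilpotent L) {a b c : ℕ}
    (h : lieType ℚ L = [a, b, c]) :
    lowerCentralSeries ℚ L L 3 = ⊥ ∧ lieTypeEntry ℚ L 0 = a ∧ lieTypeEntry ℚ L 1 = b ∧
      lieTypeEntry ℚ L 2 = c := by
  have hlen : nilpotencyLength L L = 3 := by
    have := congrArg List.length h
    simpa [lieType] using this
  rw [lieType, hlen] at h
  simp only [List.range_succ, List.range_zero, List.nil_append, List.map_cons,
    List.map_nil, List.cons_append, List.cons.injEq, and_true] at h
  refine ⟨?_, h⟩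
  have h1 : lowerCentralSeries ℤ L L 3 = ⊥ := by
    have h2 : LieModule.IsNilpotent L L := hnil
    have h4 : (nilpotencyLength L L) ∈ {k | lowerCentralSeries ℤ L L k = ⊥} :=
      Nat.sInf_mem ((LieModule.isNilpotent_iff ℤ L L).1 h2)
    rwa [hlen] at h4
  rw [← SetLike.coe_set_eq, coe_lowerCentralSeries_eq_int, h1]
  rfl

/-- The algebraic closure is algebraic with respect to its `ℚ`-algebra structure as a field of
characteristic zero. -/
theorem isAlgebraic_algebraicClosure_rat : Algebra.IsAlgebraic ℚ (AlgebraicClosure ℚ) := by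
  have h : (DivisionRing.toRatAlgebra : Algebra ℚ (AlgebraicClosure ℚ)) =
      AlgebraicClosure.instAlgebra ℚ := Subsingleton.elim _ _
  rw [h]
  exact AlgebraicClosure.isAlgebraic ℚ

end TypeEntries

/-! ### Anosov Lie algebras of types `(6, 2, 3)` and `(6, 2, 2)` -/

theorem mainTheorem10 :
    (¬ ∃ (L : Type*) (_ : LieRing L) (_ : LieAlgebra ℚ L) (_ : Module.Finite ℚ L),
      IsAnosovLieAlgebra L ∧ lieType ℚ L = [6, 2, 3]) ∧
    (∀ (L : Type*) [LieRing L] [LieAlgebra ℚ L] [Module.Finite ℚ L],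
      IsAnosovLieAlgebra L → lieType ℚ L = [6, 2, 2] → HasPositiveGrading ℚ L) := by
  have := isAlgebraic_algebraicClosure_rat
  refine ⟨?_, fun L _ _ _ hL ht => ?_⟩
  · rintro ⟨L, _, _, _, ⟨hnil, A, hh, hi⟩, ht⟩
    obtain ⟨h3, -, ht1, ht2⟩ := lieType_eq_three hnil ht
    have hφ : ∀ x y, (A.toLinearEquiv : L →ₗ[ℚ] L) ⁅x, y⁆ =
        ⁅(A.toLinearEquiv : L →ₗ[ℚ] L) x, (A.toLinearEquiv : L →ₗ[ℚ] L) y⁆ :=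
      fun x y => LieHom.map_lie A.toLieHom x y
    obtain ⟨E, ⟨q, hq, hqm, hq2, hqμ⟩, ⟨p, hp, hpm, hp3, hpν⟩, hμ1, hν1⟩ :=
      exists_eigenFrame (F := AlgebraicClosure ℚ) hφ hh hi h3 ht1 (by norm_num) le_rfl ht2
    exact false_of_three hφ hh h3 E hq hqm hq2 hqμ hp hpm hp3 hpν hμ1 hν1
  · obtain ⟨hnil, A, hh, hi⟩ := hL
    obtain ⟨h3, ht0, ht1, ht2⟩ := lieType_eq_three hnil ht
    have hφ : ∀ x y, (A.toLinearEquiv : L →ₗ[ℚ] L) ⁅x, y⁆ =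
        ⁅(A.toLinearEquiv : L →ₗ[ℚ] L) x, (A.toLinearEquiv : L →ₗ[ℚ] L) y⁆ :=
      fun x y => LieHom.map_lie A.toLieHom x y
    obtain ⟨E, ⟨q, hq, hqm, -, hqμ⟩, ⟨p, hp, hpm, -, hpν⟩, hμ1, hν1⟩ :=
      exists_eigenFrame (F := AlgebraicClosure ℚ) hφ hh hi h3 ht1 (by norm_num) (by norm_num) ht2
    refine hasPositiveGrading_of_two hφ A.toLinearEquiv.surjective hh hi h3 E hq hqm hqμ hp hpm hpν
      hμ1 hν1 ?_
    have h1 := finrank_quotient_submoduleOf_add (K := ℚ)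
      (antitone_lowerCentralSeries ℚ L L zero_le_one :
        (lowerCentralSeries ℚ L L 1).toSubmodule ≤ (lowerCentralSeries ℚ L L 0).toSubmodule)
    rw [lieTypeEntry] at ht0
    rw [ht0] at h1
    have h2 : finrank ℚ (lowerCentralSeries ℚ L L 0).toSubmodule = finrank ℚ L := by
      rw [lowerCentralSeries_zero, LieSubmodule.top_toSubmodule, finrank_top]
    rw [← h2, ← h1, add_comm]
    rfl
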